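/- Let $N\ge 1$ and consider $N+1$ qubits $A_1,\dots,A_N,A_{N+1}$ (in this order), with Hilbert space $(\mathbb C^2)^{\otimes (N+1)}$. Let $|\psi^-\rangle=(|01\rangle-|10\rangle)/\sqrt2$ and, for $1\le i\le N$, let $\sigma^{(i)}=2^{-(N-1)}\,|\psi^-\rangle\langle\psi^-|_{A_iA_{N+1}}\otimes I$, $\rho=\sum_{i=1}^N\sigma^{(i)}$, and $$\Pi_i=\rho^{-1/2}\sigma^{(i)}\rho^{-1/2}+\frac1N\Big(I-\sum_{l=1}^N\rho^{-1/2}\sigma^{(l)}\rho^{-1/2}\Big),$$ where $\rho^{-1/2}$ is the inverse square root on the support of $\rho$ and $0$ on its kernel (the square-root measurement of deterministic port-based teleportation). **Schur states.** A label consists of half-integers $\kappa_0,\kappa_1,\dots,\kappa_{N+1}\ge 0$ with $\kappa_0=0$ and $|\kappa_{r+1}-\kappa_r|=\tfrac12$, and of $m\in\{-\kappa_{N+1},-\kappa_{N+1}+1,\dots,\kappa_{N+1}\}$. Write $k=\kappa_{N-1}$, $j=\kappa_N$, $s=\kappa_{N+1}$, and $\tilde k$ for the remaining spins $(\kappa_r)_{r\le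 N-2}$. Identify $|0\rangle,|1\rangle$ with $|x\rangle$, $x=\tfrac12,-\tfrac12$. The Schur state with this label is $$|\tilde k,k,j,s,m\rangle=\sum_{x_1+\dots+x_{N+1}=m}\ \prod_{r=0}^{N}C^{\kappa_{r+1},\,x_1+\dots+x_{r+1}}_{\kappa_r,\,x_1+\dots+x_r;\ \frac12,\,x_{r+1}}\ |x_1\dots x_{N+1}\rangle ,$$ where $C$ denotes the $SU(2)$ Clebsch–Gordan coefficients $$C^{J\pm\frac12,M}_{J,M-\frac12;\frac12,\frac12}=\pm\sqrt{\tfrac12\Big(1\pm\tfrac{M}{J+1/2}\Big)},\qquad C^{J\pm\frac12,M}_{J,M+\frac12;\frac12,-\frac12}=\sqrt{\tfrac12\Big(1\mp\tfrac{M}{J+1/2}\Big)}$$ (and $0$ if the first $Z$-spin exceeds $J$ in absolute value). **Coefficients.** Let $\lambda^-_j=2^{-N}(\tfrac N2-j)$, $\lambda^+_j=2^{-N}(\tfrac N2+j+1)$ and $$\alpha(s)=\frac{\sqrt{s/(2s+1)}}{\sqrt{2^{N-1}\lambda^-_{s-1/2}}},\qquad \beta(s)=-\frac{\sqrt{(s+1)/(2s+1)}}{\sqrt{2^{N-1}\lambda^+_{s+1/2}}}.$$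 Then: 1. The Schur states form an orthonormal basis, and the Schur state with label $(\kappa,m)$ is an eigenvector of the total angular momentum $S^2_{\{1,\dots,r\}}$ of the first $r$ qubits with eigenvalue $\kappa_r(\kappa_r+1)$ for every $0\le r\le N+1$, and of the total $Z$-spin operator with eigenvalue $m$. 2. The following vectors form an orthonormal basis of $(\mathbb C^2)^{\otimes(N+1)}$ and are eigenvectors of $\Pi_N$ with the eigenvalues shown: - the Schur states with $s=\frac{N+1}2$ (maximal spin): eigenvalue $\frac1N$; - the Schur states with $s<\frac{N+1}2$ and $k\ne s$: eigenvalue $0$; - for $k=s\geq\frac12$: $\ \dfrac{\beta(s)\,|\tilde k,s,s-\frac12,s,m\rangle-\alpha(s)\,|\tilde k,s,s+\frac12,s,m\rangle}{\sqrt{\alpha(s)^2+\beta(s)^2}}$: eigenvalue $0$; - for $k=s\geq 0$: $\ \dfrac{\alpha(s)\,|\tilde k,s,s-\frac12,s,m\rangle+\beta(s)\,|\tilde k,s,s+\frac12,s,m\rangle}{\sqrt{\alpha(s)^2+\beta(s)^2}}$: eigenvalue $\alpha(s)^2+\beta(s)^2$ (for $s=0$ the first term is absent, as $\alpha(0)=0$).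 3. For every total spin $s<\frac{N+1}2$ that occurs, $\displaystyle\alpha(s)^2+\beta(s)^2=\frac{4(N+1)}{(N+1-2s)(N+3+2s)}$. 4. For every $1\le i\le N$, $\Pi_i=\mathrm{SWAP}_{A_iA_N}\,\Pi_N\,\mathrm{SWAP}_{A_iA_N}$; hence the images under $\mathrm{SWAP}_{A_iA_N}$ of the vectors in 2 form an orthonormal basis of eigenvectors of $\Pi_i$ with the same eigenvalues. -/

import Mathlib

namespace PBT

noncomputable section

/-! ### Qubits and operators -/

/-- Computational basis labels of `n` qubits. -/
abbrev Bits (n : ℕ) : Type := Fin n → Fin 2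

/-- The Hilbert space `(ℂ²)^{⊗ n}` of `n` qubits. -/
abbrev Qubits (n : ℕ) : Type := EuclideanSpace ℂ (Bits n)

/-- Operators on `n` qubits, written as matrices in the computational basis. -/
abbrev Op (n : ℕ) : Type := Matrix (Bits n) (Bits n) ℂ

/-- The action of an operator on a state vector. -/
def act {n : ℕ} (A : Op n) (v : Qubits n) : Qubits n := Matrix.toEuclideanLin A v

/-- The single-qubit operator `P` acting on qubit `i` (identity on all other qubits). -/
def onQubit {n : ℕ} (i : Fin n) (P : Matrix (Fin 2) (Fin 2) ℂ) : Op n :=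
  Matrix.of fun x y => if ∀ l, l ≠ i → x l = y l then P (x i) (y i) else 0

/-- The Pauli matrices `σ_x, σ_y, σ_z`, indexed by `0, 1, 2`. -/
def pauli : Fin 3 → Matrix (Fin 2) (Fin 2) ℂ :=
  ![!![0, 1; 1, 0], !![0, -Complex.I; Complex.I, 0], !![1, 0; 0, -1]]

/-- The component along axis `c` of the angular momentum of a set `a` of qubits. -/
def spinComp {n : ℕ} (a : Finset (Fin n)) (c : Fin 3) : Op n :=
  ∑ i ∈ a, (1 / 2 : ℂ) • onQubit i (pauli c)

/-- The total angular momentum operator `S²_a`. -/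
def totalSpin {n : ℕ} (a : Finset (Fin n)) : Op n :=
  ∑ c : Fin 3, spinComp a c * spinComp a c

/-- The first `r` qubits. -/
def firstQubits {n : ℕ} (r : Fin (n + 1)) : Finset (Fin n) :=
  Finset.univ.filter fun i => (i : ℕ) < (r : ℕ)

/-- The operator exchanging the qubits `a` and `b`. -/
def swapOp {n : ℕ} (a b : Fin n) : Op n :=
  Matrix.of fun x y => if x = y ∘ Equiv.swap a b then 1 else 0

/-! ### The sequentially coupled Schur basis

All spins and `Z`-spins are half-integers and are stored doubled, as integers. -/

/-- Twice the `Z`-spin of a computational basis state of one qubit: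
`|0⟩` has `Z`-spin `1/2` and `|1⟩` has `Z`-spin `-1/2`. -/
def twiceZ (x : Fin 2) : ℤ := if x = 0 then 1 else -1

/-- The Clebsch-Gordan coefficient `C^{J,M}_{j,m₁; 1/2,m₂}` of `SU(2)`, with `a = 2j`, `p = 2m₁`,
`b = 2J`, `t = 2M`, and `m₂` the `Z`-spin of `|x⟩`. -/
def cgHalf (a : ℕ) (p : ℤ) (x : Fin 2) (b : ℕ) (t : ℤ) : ℝ :=
  if |p| ≤ (a : ℤ) ∧ p + twiceZ x = t then
    if b = a + 1 then
      if x = 0 then √(1 / 2 * (1 + (t : ℝ) / ((a : ℝ) + 1)))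
      else √(1 / 2 * (1 - (t : ℝ) / ((a : ℝ) + 1)))
    else if a = b + 1 then
      if x = 0 then -√(1 / 2 * (1 - (t : ℝ) / ((a : ℝ) + 1)))
      else √(1 / 2 * (1 + (t : ℝ) / ((a : ℝ) + 1)))
    else 0
  else 0

/-- Twice the `Z`-spin of the first `r` qubits in the computational basis state `|x⟩`. -/
def partialZ {n : ℕ} (x : Bits n) (r : Fin (n + 1)) : ℤ :=
  ∑ i ∈ firstQubits r, twiceZ (x i)

/-- The ket `|spin, m⟩` on `n` qubits obtained by coupling the qubits one after the other with
Clebsch-Gordan coefficients: `spin r` is twice the spin of the first `r` qubits (with spin `0` on no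
qubits), `m` is twice the `Z`-spin of all of them. If `spin` has a step other than `± 1`, i.e. if it
breaks the coupling rules, this is the zero vector. -/
def schurKet (n : ℕ) (spin : Fin (n + 1) → ℕ) (m : ℤ) : Qubits n :=
  WithLp.toLp 2 fun x =>
    if partialZ x (Fin.last n) = m then
      ((∏ r : Fin n,
        cgHalf (spin r.castSucc) (partialZ x r.castSucc) (x r) (spin r.succ)
          (partialZ x r.succ) : ℝ) : ℂ)
    else 0

/-- The admissible labels of Schur states on `n` qubits. -/
@[ext]
structure SchurLabel (n : ℕ) where
  /-- twice the spin of the first `r` qubits -/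
  spin : Fin (n + 1) → ℕ
  spin_zero : spin 0 = 0
  spin_step : ∀ r : Fin n, spin r.succ = spin r.castSucc + 1 ∨ spin r.castSucc = spin r.succ + 1
  /-- twice the `Z`-spin of all qubits -/
  m : ℤ
  m_range : |m| ≤ (spin (Fin.last n) : ℤ)
  m_parity : Even ((spin (Fin.last n) : ℤ) - m)

/-- The Schur state with a given label. -/
def schurState {n : ℕ} (x : SchurLabel n) : Qubits n := schurKet n x.spin x.m

/-- A family of vectors is an orthonormal basis. -/
def IsONB {ι : Type} {n : ℕ} (v : ι → Qubits n) : Prop :=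
  Orthonormal ℂ v ∧ Submodule.span ℂ (Set.range v) = ⊤

/-- `v` is an orthonormal simultaneous eigenbasis of `S²_{1,…,r}` (all `r`) and `Z`, whose member
at label `x` has the spins and the `Z`-spin that `x` records. -/
def IsSpinEigenbasis {n : ℕ} (v : SchurLabel n → Qubits n) : Prop :=
  IsONB v ∧
  (∀ (x : SchurLabel n) (r : Fin (n + 1)),
    act (totalSpin (firstQubits r)) (v x) =
      ((x.spin r : ℂ) / 2 * ((x.spin r : ℂ) / 2 + 1)) • v x) ∧
  (∀ x : SchurLabel n, act (spinComp Finset.univ 2) (v x) = ((x.m : ℂ) / 2) • v x)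

/-! ### The square-root measurement

There are `N + 1` qubits: the ports `A_1, …, A_N` are the qubits `i.castSucc`, `i : Fin N`, and the
input `A_{N+1}` is the qubit `Fin.last N`. -/

/-- The singlet `|ψ⁻⟩ = (|01⟩ - |10⟩)/√2`. -/
def singlet (x y : Fin 2) : ℂ :=
  if x = 0 ∧ y = 1 then 1 / ((√2 : ℝ) : ℂ)
  else if x = 1 ∧ y = 0 then -(1 / ((√2 : ℝ) : ℂ)) else 0

/-- `σ^{(i)} = 2^{-(N-1)} |ψ⁻⟩⟨ψ⁻|_{A_i A_{N+1}} ⊗ I`. -/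
def sigma (N : ℕ) (i : Fin N) : Op (N + 1) :=
  ((1 : ℂ) / 2 ^ (N - 1)) • Matrix.of fun x y =>
    if ∀ l, l ≠ i.castSucc → l ≠ Fin.last N → x l = y l then
      singlet (x i.castSucc) (x (Fin.last N)) * star (singlet (y i.castSucc) (y (Fin.last N)))
    else 0

/-- `ρ = ∑ᵢ σ^{(i)}`. -/
def rho (N : ℕ) : Op (N + 1) := ∑ i, sigma N i

/-- `ρ^{-1/2}`, the inverse being taken on the support of `ρ` only (`(√0)⁻¹ = 0`). -/
def rhoInvSqrt (N : ℕ) : Op (N + 1) := cfc (fun t : ℝ => (√t)⁻¹) (rho N)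

/-- `Δ = (I - ∑ᵢ ρ^{-1/2} σ^{(i)} ρ^{-1/2}) / N`. -/
def excess (N : ℕ) : Op (N + 1) :=
  ((1 : ℂ) / N) • (1 - ∑ i, rhoInvSqrt N * sigma N i * rhoInvSqrt N)

/-- The POVM element `Π_i = ρ^{-1/2} σ^{(i)} ρ^{-1/2} + Δ`. -/
def povm (N : ℕ) (i : Fin N) : Op (N + 1) :=
  rhoInvSqrt N * sigma N i * rhoInvSqrt N + excess N

/-- The last port `A_N`. -/
def lastPort (N : ℕ) (hN : 1 ≤ N) : Fin N := ⟨N - 1, by omega⟩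

/-! ### The rotated basis -/

/-- `λ⁻_j = (N/2 - j) / 2^N`. -/
def lamMinus (N : ℕ) (j : ℝ) : ℝ := 1 / 2 ^ N * ((N : ℝ) / 2 - j)

/-- `λ⁺_j = (N/2 + j + 1) / 2^N`. -/
def lamPlus (N : ℕ) (j : ℝ) : ℝ := 1 / 2 ^ N * ((N : ℝ) / 2 + j + 1)

/-- `α(s)`. -/
def alpha (N : ℕ) (s : ℝ) : ℝ :=
  √(s / (2 * s + 1)) / √(2 ^ (N - 1) * lamMinus N (s - 1 / 2))

/-- `β(s)`. -/
def beta (N : ℕ) (s : ℝ) : ℝ :=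
  -√((s + 1) / (2 * s + 1)) / √(2 ^ (N - 1) * lamPlus N (s + 1 / 2))

namespace SchurLabel

variable {N : ℕ}

/-- Twice the spin `k_{N-2}` of the first `N - 1` qubits. -/
def twoK (x : SchurLabel (N + 1)) : ℕ := x.spin ⟨N - 1, by omega⟩

/-- Twice the spin `j` of the first `N` qubits. -/
def twoJ (x : SchurLabel (N + 1)) : ℕ := x.spin ⟨N, by omega⟩

/-- Twice the spin `s` of all `N + 1` qubits. -/
def twoS (x : SchurLabel (N + 1)) : ℕ := x.spin (Fin.last (N + 1))

/-- The spin `s` of all `N + 1` qubits. -/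
def s (x : SchurLabel (N + 1)) : ℝ := (x.twoS : ℝ) / 2

/-- The ket `|k, j, s, m⟩` with `k, s, m` from `x` and with `2j` set to `a`. -/
def ketWithJ (x : SchurLabel (N + 1)) (a : ℕ) : Qubits (N + 1) :=
  schurKet (N + 1) (Function.update x.spin ⟨N, by omega⟩ a) x.m

/-- `|k̃, s, s - 1/2, s, m⟩`. For `s = 0` no such state exists and the vector below is zero (the
natural subtraction returns `2j = 0`, which breaks the coupling rules). -/
def lowerKet (x : SchurLabel (N + 1)) : Qubits (N + 1) := x.ketWithJ (x.twoS - 1)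

/-- `|k̃, s, s + 1/2, s, m⟩`. -/
def upperKet (x : SchurLabel (N + 1)) : Qubits (N + 1) := x.ketWithJ (x.twoS + 1)

/-- `√(α(s)² + β(s)²)`. -/
def rotNorm (x : SchurLabel (N + 1)) : ℝ := √(alpha N x.s ^ 2 + beta N x.s ^ 2)

/-- `(β(s) |k̃, s, s - 1/2, s, m⟩ - α(s) |k̃, s, s + 1/2, s, m⟩) / √(α(s)² + β(s)²)`. -/
def rotMinus (x : SchurLabel (N + 1)) : Qubits (N + 1) :=
  ((beta N x.s / x.rotNorm : ℝ) : ℂ) • x.lowerKet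
    - ((alpha N x.s / x.rotNorm : ℝ) : ℂ) • x.upperKet

/-- `(α(s) |k̃, s, s - 1/2, s, m⟩ + β(s) |k̃, s, s + 1/2, s, m⟩) / √(α(s)² + β(s)²)`. -/
def rotPlus (x : SchurLabel (N + 1)) : Qubits (N + 1) :=
  ((alpha N x.s / x.rotNorm : ℝ) : ℂ) • x.lowerKet
    + ((beta N x.s / x.rotNorm : ℝ) : ℂ) • x.upperKet

/-- The rotated basis: Schur states with `k_{N-2} ≠ s` (in particular those of maximal spin) are
kept, and each pair of Schur states with `k_{N-2} = s`, `j = s ∓ 1/2` is rotated. -/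
def eigVec (x : SchurLabel (N + 1)) : Qubits (N + 1) :=
  if x.twoK = x.twoS then
    if x.twoJ + 1 = x.twoS then x.rotMinus else x.rotPlus
  else schurState x

/-- The eigenvalues: `1/N` at maximal spin, `α(s)² + β(s)²` at the vectors `rotPlus`, else `0`. -/
def eigVal (x : SchurLabel (N + 1)) : ℝ :=
  if x.twoS = N + 1 then 1 / N
  else if x.twoK = x.twoS ∧ x.twoJ = x.twoS + 1 then alpha N x.s ^ 2 + beta N x.s ^ 2
  else 0

end SchurLabel

end

end PBT

/-!
Write `(i l)` for the exchange of qubits `i` and `l`. Then `σ^{(i)} = 2^{-N} (1 - (i (N+1)))`, hence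
`ρ = 2^{-N} (N - J)` for the last Jucys-Murphy element `J = ∑ i, (i (N+1))`. The Schur states
are its eigenvectors: the eigenvalue is the content of the box that the last coupling step adds to
the Young diagram. This yields `ρ^{-1/2}` and the excess term of the measurement on Schur states;
the earlier Jucys-Murphy elements yield the spins of the first qubits, as
`S²_{1,…,r+1} - S²_{1,…,r}` is `J_{r+1}` plus a constant.

On the space of the last two qubits, `σ^{(N)}` is a multiple of the projection onto the singlet.
Coupled to a state of spin `k`, the singlet has spin `s = k` and lies in the span of the two
Schur states with `k = s` and `j = s ± 1/2`. Thus `Π_N` has rank one on such a pair: it is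
`|v⟩⟨v|` for `v = α |s - 1/2⟩ + β |s + 1/2⟩`, and rotating each pair diagonalizes it. The other
elements of the measurement are conjugate to `Π_N` because permutations of the ports fix `ρ`.
-/

namespace PBT

noncomputable section

/-! ### Clebsch-Gordan coefficients -/

/-- `t / 2` is a `Z`-spin occurring in the representation of spin `a / 2`. -/
def IsWeight (a : ℕ) (t : ℤ) : Prop := |t| ≤ (a : ℤ) ∧ Even ((a : ℤ) - t)

/-- The doubled spins `a` and `b` are joined by the coupling of one more qubit. -/
def Step (a b : ℕ) : Prop := b = a + 1 ∨ a = b + 1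

/-- The Clebsch-Gordan coefficient for coupling the qubit state `|x⟩` to a spin `a / 2`, with total
spin `b / 2` and total `Z`-spin `t / 2`. -/
def cg (a : ℕ) (x : Fin 2) (b : ℕ) (t : ℤ) : ℝ := cgHalf a (t - twiceZ x) x b t

/-- The common shape `√((1 + t / (a + 1)) / 2)` of all Clebsch-Gordan coefficients `cg`, up to
sign. -/
def cgAmp (a : ℕ) (t : ℝ) : ℝ := √(1 / 2 * (1 + t / ((a : ℝ) + 1)))

lemma twiceZ_eq_one_or_neg_one (x : Fin 2) : twiceZ x = 1 ∨ twiceZ x = -1 := by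
  fin_cases x <;> simp [twiceZ]

lemma abs_twiceZ (x : Fin 2) : |twiceZ x| = 1 := by
  rcases twiceZ_eq_one_or_neg_one x with h | h <;> simp [h]

lemma IsWeight.abs_sub_twiceZ_le {a : ℕ} {t : ℤ} (h : IsWeight a t) (x : Fin 2) :
    |t - twiceZ x| ≤ (a : ℤ) + 1 :=
  (abs_sub _ _).trans (add_le_add h.1 (abs_twiceZ x).le)

lemma cgAmp_neg_succ (a : ℕ) : cgAmp a (-((a : ℝ) + 1)) = 0 := by
  rw [cgAmp, neg_div, div_self (by positivity)]
  simp

lemma cgAmp_sq {a : ℕ} {t : ℝ} (h : -((a : ℝ) + 1) ≤ t) :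
    cgAmp a t ^ 2 = (a + 1 + t) / (2 * (a + 1)) := by
  have ha : (0 : ℝ) < a + 1 := by positivity
  rw [cgAmp, Real.sq_sqrt]
  · field_simp
  · have : -1 ≤ t / ((a : ℝ) + 1) := by rw [le_div_iff₀ ha]; linarith
    linarith

lemma cgAmp_sq_add_cgAmp_neg_sq {a : ℕ} {t : ℝ} (h : |t| ≤ (a : ℝ) + 1) :
    cgAmp a t ^ 2 + cgAmp a (-t) ^ 2 = 1 := by
  obtain ⟨h₁, h₂⟩ := abs_le.mp h
  rw [cgAmp_sq h₁, cgAmp_sq (by linarith)]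
  field_simp
  ring

lemma cgAmp_add_one (a : ℕ) (t : ℝ) :
    cgAmp a (t + 1) = √((a + 2) / (a + 1)) * cgAmp (a + 1) t := by
  rw [cgAmp, cgAmp, ← Real.sqrt_mul (by positivity)]
  congr 1
  push_cast
  field_simp
  ring

lemma cg_up {a : ℕ} {t : ℤ} (h : IsWeight (a + 1) t) (x : Fin 2) :
    cg a x (a + 1) t = cgAmp a (twiceZ x * t) := by
  obtain ⟨hr, c, hc⟩ := h
  push_cast at hr hc
  by_cases hp : |t - twiceZ x| ≤ (a : ℤ)
  · fin_cases x <;> simp_all [cg, cgHalf, cgAmp, twiceZ, neg_div, sub_eq_add_neg]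
  · have ht : twiceZ x * t = -(a + 1) := by
      rw [abs_le] at hr hp
      rcases twiceZ_eq_one_or_neg_one x with hx | hx <;> rw [hx] at hp ⊢ <;> omega
    have ht' : ((twiceZ x : ℝ) * t) = -((a : ℝ) + 1) := by exact_mod_cast ht
    rw [ht', cgAmp_neg_succ]
    simp [cg, cgHalf, hp]

-- For `a = 0` both sides vanish: then `a - 1 = 0` is not a step from `a`.
lemma cg_down {a : ℕ} {t : ℤ} {x : Fin 2} (h : |t - twiceZ x| ≤ (a : ℤ)) :
    cg a x (a - 1) t = -twiceZ x * cgAmp a (-(twiceZ x * t)) := by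
  obtain _ | a := a
  · have ht : t = twiceZ x := by simpa [sub_eq_zero] using h
    subst ht
    fin_cases x <;> simp [cg, cgHalf, cgAmp, twiceZ]
  · have ha : a ≠ a + 1 + 1 := by omega
    fin_cases x <;> simp_all [-mul_inv_rev, cg, cgHalf, cgAmp, twiceZ, neg_div, sub_eq_add_neg]

lemma cg_down_of_isWeight {a : ℕ} {t : ℤ} (h : IsWeight a t) (x : Fin 2) :
    cg (a + 1) x a t = -twiceZ x * cgAmp (a + 1) (-(twiceZ x * t)) :=
  cg_down (a := a + 1) (h.abs_sub_twiceZ_le x)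

lemma cg_eq_zero_of_lt {a : ℕ} {t : ℤ} {x : Fin 2} (h : ¬ |t - twiceZ x| ≤ (a : ℤ)) (b : ℕ) :
    cg a x b t = 0 := by
  simp [cg, cgHalf, h]

lemma cg_eq_zero_of_not_step {a b : ℕ} (h : ¬ Step a b) (x : Fin 2) (t : ℤ) :
    cg a x b t = 0 := by
  simp only [Step, not_or] at h
  simp [cg, cgHalf, h.1, h.2]

lemma IsWeight.of_cg_ne_zero {a b : ℕ} {t : ℤ} {x : Fin 2} (hp : IsWeight a (t - twiceZ x))
    (h : cg a x b t ≠ 0) : IsWeight b t := by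
  obtain ⟨hr, c, hc⟩ := id hp
  have hab : Step a b := by
    by_contra hab
    exact h (cg_eq_zero_of_not_step hab x t)
  refine ⟨?_, Int.even_iff.mpr ?_⟩
  · by_contra hb
    obtain ⟨ha, ht⟩ : a = b + 1 ∧ -(twiceZ x * t) = -(a + 1) := by
      rw [abs_le] at hr hb
      rcases hab with rfl | rfl <;> rcases twiceZ_eq_one_or_neg_one x with hx | hx <;>
        rw [hx] at hr hc ⊢ <;> push_cast at * <;> omega
    have ht' : -((twiceZ x : ℝ) * t) = -((a : ℝ) + 1) := by exact_mod_cast ht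
    refine h ?_
    rw [show b = a - 1 by omega, cg_down hr, ht', cgAmp_neg_succ, mul_zero]
  · rcases hab with rfl | rfl <;> rcases twiceZ_eq_one_or_neg_one x with hx | hx <;>
      rw [hx] at hc <;> push_cast at * <;> omega

lemma IsWeight.sub_twiceZ_of_cg_ne_zero {a b : ℕ} {t : ℤ} {x : Fin 2} (hab : Step a b)
    (ht : IsWeight b t) (h : cg a x b t ≠ 0) : IsWeight a (t - twiceZ x) := by
  obtain ⟨-, c, hc⟩ := ht
  refine ⟨by_contra fun hr => h (cg_eq_zero_of_lt hr b), Int.even_iff.mpr ?_⟩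
  rcases hab with rfl | rfl <;> rcases twiceZ_eq_one_or_neg_one x with hx | hx <;>
    rw [hx] <;> push_cast at * <;> omega

lemma sum_cg_mul_cg {a b c : ℕ} (hb : Step a b) (hc : Step a c) {t : ℤ} (htb : IsWeight b t)
    (htc : IsWeight c t) : ∑ x, cg a x b t * cg a x c t = if b = c then 1 else 0 := by
  have hsq (n : ℕ) (h : |t| ≤ (n : ℤ) + 1) : cgAmp n t ^ 2 + cgAmp n (-t) ^ 2 = 1 :=
    cgAmp_sq_add_cgAmp_neg_sq (by exact_mod_cast h)
  rw [Fin.sum_univ_two]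
  rcases hb with rfl | rfl <;> rcases hc with rfl | hc
  · have := hsq a (mod_cast htb.1)
    simp only [cg_up htb, twiceZ, if_true, one_ne_zero, if_false]
    push_cast
    rw [one_mul, neg_one_mul]
    linarith
  · subst hc
    rw [if_neg (by omega)]
    simp only [cg_up htb, cg_down_of_isWeight htc, twiceZ, if_true, one_ne_zero, if_false]
    push_cast
    ring_nf
  · rw [if_neg (by omega)]
    simp only [cg_up htc, cg_down_of_isWeight htb, twiceZ, if_true, one_ne_zero, if_false]
    push_cast
    ring_nf
  · obtain rfl : b = c := by omega
    have := hsq (b + 1) (htb.1.trans (by push_cast; linarith))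
    simp only [cg_down_of_isWeight htb, twiceZ, if_true, one_ne_zero, if_false]
    push_cast at *
    simp only [neg_mul, one_mul, neg_neg]
    linarith

lemma cg_mul_cg_up_add_down {a : ℕ} {t : ℤ} {x : Fin 2} (h : IsWeight a (t - twiceZ x))
    (y : Fin 2) :
    cg a x (a + 1) t * cg a y (a + 1) t + cg a x (a - 1) t * cg a y (a - 1) t =
      if x = y then 1 else 0 := by
  obtain ⟨hr, c, hc⟩ := id h
  have ht : IsWeight (a + 1) t := by
    refine ⟨?_, Int.even_iff.mpr ?_⟩
    · rw [abs_le] at *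
      rcases twiceZ_eq_one_or_neg_one x with hx | hx <;> rw [hx] at hr <;> push_cast <;> omega
    · rcases twiceZ_eq_one_or_neg_one x with hx | hx <;> rw [hx] at hc <;> push_cast <;> omega
  have ht' : |(t : ℝ)| ≤ (a : ℝ) + 1 := by exact_mod_cast ht.1
  by_cases hy : |t - twiceZ y| ≤ (a : ℤ)
  · have hsq := cgAmp_sq_add_cgAmp_neg_sq ht'
    rw [cg_up ht, cg_up ht, cg_down hr, cg_down hy]
    fin_cases x <;> fin_cases y <;> simp [twiceZ] <;> linarith
  · rw [cg_eq_zero_of_lt hy, cg_eq_zero_of_lt hy, if_neg]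
    · simp
    · rintro rfl
      exact hy hr

/-! ### Coupling two qubits -/

/-- The amplitude for coupling first `|x⟩` and then `|y⟩` to a spin `k / 2`, with intermediate spin
`j / 2`, total spin `s / 2` and total `Z`-spin `m / 2`. -/
def cgPair (k j s : ℕ) (m : ℤ) (x y : Fin 2) : ℝ := cg k x j (m - twiceZ y) * cg j y s m

/-- `√2` times the overlap of the state in which two qubits are coupled to a spin `a / 2` through
the spin `j / 2` to total spin `a / 2` with the state in which the two qubits form a singlet. -/
def singletAmp (a j : ℕ) : ℝ := if j = a + 1 then √((a + 2) / (a + 1)) else -√(a / (a + 1))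

lemma singletAmp_up (a : ℕ) : singletAmp a (a + 1) = √((a + 2) / (a + 1)) := if_pos rfl

lemma singletAmp_down (a : ℕ) : singletAmp a (a - 1) = -√(a / (a + 1)) := if_neg (by omega)

lemma cgPair_eq_of_cg_eq {k j s : ℕ} {m : ℤ} {x y : Fin 2} {c : ℝ} (hjs : Step j s)
    (hm : IsWeight s m) (h : IsWeight j (m - twiceZ y) → cg k x j (m - twiceZ y) = c) :
    cgPair k j s m x y = c * cg j y s m := by
  by_cases hy : cg j y s m = 0
  · rw [cgPair, hy, mul_zero, mul_zero]
  · rw [cgPair, h (hm.sub_twiceZ_of_cg_ne_zero hjs hy)]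

lemma cgPair_up {k s : ℕ} {m : ℤ} (hs : Step (k + 1) s) (hm : IsWeight s m) (x y : Fin 2) :
    cgPair k (k + 1) s m x y =
      cgAmp k (twiceZ x * (m - twiceZ y)) * cg (k + 1) y s m :=
  cgPair_eq_of_cg_eq hs hm fun h => by rw [cg_up h, Int.cast_sub]

lemma cgPair_down {k s : ℕ} {m : ℤ} (hs : Step k s) (hm : IsWeight s m) (x y : Fin 2) :
    cgPair (k + 1) k s m x y =
      -twiceZ x * cgAmp (k + 1) (-(twiceZ x * (m - twiceZ y))) * cg k y s m :=
  cgPair_eq_of_cg_eq hs hm fun h => by rw [cg_down_of_isWeight h, Int.cast_sub]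

lemma cgPair_comm {k j s : ℕ} {m : ℤ} (hkj : Step k j) (hjs : Step j s) (hks : k ≠ s)
    (hm : IsWeight s m) (x y : Fin 2) : cgPair k j s m x y = cgPair k j s m y x := by
  rcases hkj with rfl | rfl <;> rcases hjs with rfl | hjs
  · simp only [cgPair_up (.inl rfl) hm, cg_up hm]
    have h₁ := cgAmp_add_one k m
    have h₂ := cgAmp_add_one k (-m)
    fin_cases x <;> fin_cases y <;> simp_all [twiceZ, neg_add_eq_sub] <;> ring
  · omega
  · omega
  · subst hjs
    simp only [cgPair_down (.inr rfl) hm, cg_down_of_isWeight hm]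
    have h (t : ℝ) : cgAmp (s + 1) t = √(((s + 1 : ℕ) + 2) / ((s + 1 : ℕ) + 1)) *
        cgAmp (s + 1 + 1) (t - 1) := by rw [← cgAmp_add_one, sub_add_cancel]
    fin_cases x <;> fin_cases y <;> simp_all [twiceZ] <;> ring_nf

lemma singletAmp_up_mul_cgPair {a : ℕ} {m : ℤ} (hm : IsWeight a m) (x y : Fin 2) :
    singletAmp a (a + 1) * cgPair a (a + 1) a m x y =
      -twiceZ y * (cgAmp a (twiceZ x * (m - twiceZ y)) * cgAmp a (1 - twiceZ y * m)) := by
  rw [cgPair_up (.inr rfl) hm, cg_down_of_isWeight hm,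
    show (1 : ℝ) - twiceZ y * m = -(twiceZ y * m) + 1 by ring, cgAmp_add_one, singletAmp_up]
  ring

lemma singletAmp_down_mul_cgPair {a : ℕ} {m : ℤ} (hm : IsWeight a m) (x y : Fin 2) :
    singletAmp a (a - 1) * cgPair a (a - 1) a m x y =
      twiceZ x * (cgAmp a (-(twiceZ x * (m - twiceZ y))) * cgAmp a (twiceZ y * m - 1)) := by
  obtain _ | a := a
  · have hm0 : m = 0 := by simpa using hm.1
    simp [singletAmp, hm0, cgAmp]
  · have hcancel : √(((a : ℝ) + 1) / (a + 2)) * √((a + 2) / (a + 1)) = 1 := by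
      rw [← Real.sqrt_mul (by positivity), div_mul_div_cancel₀ (by positivity),
        div_self (by positivity), Real.sqrt_one]
    have hshift := cgAmp_add_one a (twiceZ y * m - 1)
    rw [sub_add_cancel] at hshift
    rw [singletAmp_down, Nat.add_sub_cancel, cgPair_down (.inl rfl) hm, cg_up hm, hshift,
      show ((a + 1 : ℕ) : ℝ) / ((a + 1 : ℕ) + 1) = (a + 1) / (a + 2) by push_cast; ring]
    linear_combination (twiceZ x * (cgAmp (a + 1) (-(twiceZ x * (m - twiceZ y))) *
      cgAmp (a + 1) (twiceZ y * m - 1))) * hcancel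

lemma sum_singletAmp_mul_cgPair {a : ℕ} {m : ℤ} (hm : IsWeight a m) (x y : Fin 2) :
    singletAmp a (a + 1) * cgPair a (a + 1) a m x y +
      singletAmp a (a - 1) * cgPair a (a - 1) a m x y = (twiceZ x - twiceZ y) / 2 := by
  rw [singletAmp_up_mul_cgPair hm, singletAmp_down_mul_cgPair hm]
  have hm' : |(m : ℝ)| ≤ a := by exact_mod_cast hm.1
  have h₁ : |(m : ℝ) + 1| ≤ a + 1 := (abs_add_le _ _).trans (by simpa using hm')
  have h₂ : |(m : ℝ) - 1| ≤ a + 1 := (abs_sub _ _).trans (by simpa using hm')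
  have := cgAmp_sq_add_cgAmp_neg_sq h₁
  have := cgAmp_sq_add_cgAmp_neg_sq h₂
  fin_cases x <;> fin_cases y <;> simp [twiceZ] <;> ring_nf at * <;> linarith

lemma singletAmp_up_sq (a : ℕ) : singletAmp a (a + 1) ^ 2 = (a + 2) / (a + 1) := by
  rw [singletAmp_up, Real.sq_sqrt (by positivity)]

lemma singletAmp_down_sq (a : ℕ) : singletAmp a (a - 1) ^ 2 = a / (a + 1) := by
  rw [singletAmp_down, neg_sq, Real.sq_sqrt (by positivity)]

lemma cgPair_up_sub_cgPair_up {a : ℕ} {m : ℤ} (hm : IsWeight a m) :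
    cgPair a (a + 1) a m 0 1 - cgPair a (a + 1) a m 1 0 = singletAmp a (a + 1) := by
  obtain ⟨hm₁, hm₂⟩ : -(a : ℝ) ≤ m ∧ (m : ℝ) ≤ a := abs_le.mp (by exact_mod_cast hm.1)
  have hne : singletAmp a (a + 1) ≠ 0 := by rw [singletAmp_up]; positivity
  have h₁ := cgAmp_sq (a := a) (t := m + 1) (by linarith)
  have h₂ := cgAmp_sq (a := a) (t := 1 - m) (by linarith)
  refine mul_left_cancel₀ hne ?_
  rw [mul_sub, singletAmp_up_mul_cgPair hm, singletAmp_up_mul_cgPair hm, ← sq, singletAmp_up_sq]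
  simp only [twiceZ, if_true, one_ne_zero, if_false, Int.cast_one, Int.cast_neg, one_mul, neg_mul,
    neg_neg, sub_neg_eq_add, neg_sub, add_comm (1 : ℝ), ← sq, h₁, h₂]
  field_simp
  ring

lemma cgPair_down_sub_cgPair_down {a : ℕ} {m : ℤ} (hm : IsWeight a m) :
    cgPair a (a - 1) a m 0 1 - cgPair a (a - 1) a m 1 0 = singletAmp a (a - 1) := by
  obtain rfl | ha := eq_or_ne a 0
  · simp [cgPair, cg_eq_zero_of_not_step, Step, singletAmp]
  obtain ⟨hm₁, hm₂⟩ : -(a : ℝ) ≤ m ∧ (m : ℝ) ≤ a := abs_le.mp (by exact_mod_cast hm.1)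
  have hne : singletAmp a (a - 1) ≠ 0 := by rw [singletAmp_down, neg_ne_zero]; positivity
  have h₁ := cgAmp_sq (a := a) (t := m - 1) (by linarith)
  have h₂ := cgAmp_sq (a := a) (t := -m - 1) (by linarith)
  refine mul_left_cancel₀ hne ?_
  rw [mul_sub, singletAmp_down_mul_cgPair hm, singletAmp_down_mul_cgPair hm, ← sq,
    singletAmp_down_sq]
  simp only [twiceZ, if_true, one_ne_zero, if_false, Int.cast_one, Int.cast_neg, one_mul, neg_mul,
    neg_neg, sub_neg_eq_add, neg_add', ← sq, h₁, h₂]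
  field_simp
  ring

lemma cgPair_sub_cgPair {a j : ℕ} {m : ℤ} (hj : Step a j) (hm : IsWeight a m) :
    cgPair a j a m 0 1 - cgPair a j a m 1 0 = singletAmp a j := by
  rcases hj with rfl | rfl
  · exact cgPair_up_sub_cgPair_up hm
  · exact cgPair_down_sub_cgPair_down hm

/-! ### Appending a qubit -/

/-- The linear map `v ↦ v ⊗ |b⟩`. -/
def appendQubit {n : ℕ} (b : Fin 2) : Qubits n →ₗ[ℂ] Qubits (n + 1) where
  toFun v := WithLp.toLp 2 fun x => if x (Fin.last n) = b then v (Fin.init x) else 0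
  map_add' v w := by ext x; by_cases h : x (Fin.last n) = b <;> simp [h]
  map_smul' c v := by ext x; by_cases h : x (Fin.last n) = b <;> simp [h]

lemma appendQubit_snoc {n : ℕ} (b c : Fin 2) (v : Qubits n) (y : Bits n) :
    appendQubit b v (Fin.snoc (α := fun _ => Fin 2) y c) = if c = b then v y else 0 := by
  simp [appendQubit]

lemma ext_snoc {n : ℕ} {v w : Qubits (n + 1)}
    (h : ∀ (y : Bits n) (c : Fin 2), v (Fin.snoc (α := fun _ => Fin 2) y c) =
      w (Fin.snoc (α := fun _ => Fin 2) y c)) : v = w := by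
  ext x
  rw [← Fin.snoc_init_self x]
  exact h _ _

lemma eq_sum_appendQubit {n : ℕ} (v : Qubits (n + 1)) :
    v = ∑ b, appendQubit b
      (WithLp.toLp 2 fun y : Bits n => v (Fin.snoc (α := fun _ => Fin 2) y b)) :=
  ext_snoc fun y c => by simp [appendQubit_snoc, -Fin.sum_univ_two]

lemma sum_bits_succ {M : Type*} [AddCommMonoid M] {n : ℕ} (f : Bits (n + 1) → M) :
    ∑ x, f x = ∑ b, ∑ y : Bits n, f (Fin.snoc (α := fun _ => Fin 2) y b) := by
  rw [← Fintype.sum_prod_type', ← (Fin.snocEquiv fun _ => Fin 2).sum_comp]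
  rfl

lemma inner_appendQubit {n : ℕ} (b c : Fin 2) (v w : Qubits n) :
    inner ℂ (appendQubit b v) (appendQubit c w) = if b = c then inner ℂ v w else 0 := by
  simp only [PiLp.inner_apply, sum_bits_succ, appendQubit_snoc]
  fin_cases b <;> fin_cases c <;> simp

/-! ### The Schur basis -/

lemma partialZ_snoc_castSucc {n : ℕ} (y : Bits n) (b : Fin 2) (r : Fin (n + 1)) :
    partialZ (Fin.snoc (α := fun _ => Fin 2) y b) r.castSucc = partialZ y r := by
  simp only [partialZ, firstQubits, Finset.sum_filter, Fin.sum_univ_castSucc, Fin.snoc_castSucc]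
  simp [show ¬ n < (r : ℕ) by omega]

lemma partialZ_snoc_last {n : ℕ} (y : Bits n) (b : Fin 2) :
    partialZ (Fin.snoc (α := fun _ => Fin 2) y b) (Fin.last (n + 1)) =
      partialZ y (Fin.last n) + twiceZ b := by
  simp only [partialZ, firstQubits, Finset.sum_filter, Fin.sum_univ_castSucc, Fin.snoc_castSucc]
  simp

lemma schurKet_succ {n : ℕ} (spin : Fin (n + 2) → ℕ) (m : ℤ) :
    schurKet (n + 1) spin m =
      ∑ b, (cg (spin (Fin.last n).castSucc) b (spin (Fin.last (n + 1))) m : ℂ) •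
        appendQubit b (schurKet n (Fin.init spin) (m - twiceZ b)) := by
  refine ext_snoc fun y c => ?_
  have hz : partialZ y (Fin.last n) + twiceZ c = m ↔
    partialZ y (Fin.last n) = m - twiceZ c := eq_sub_iff_add_eq.symm
  simp only [schurKet, partialZ_snoc_last, hz, Fin.prod_univ_castSucc, Fin.snoc_castSucc,
    Fin.snoc_last, Fin.succ_castSucc, Fin.succ_last, partialZ_snoc_castSucc, WithLp.ofLp_sum,
    WithLp.ofLp_smul, Finset.sum_apply, Pi.smul_apply, appendQubit_snoc, smul_eq_mul, mul_ite,
    mul_zero, Finset.sum_ite_eq, Finset.mem_univ, if_true]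
  split_ifs with h
  · rw [h, sub_add_cancel, Complex.ofReal_mul, mul_comm]
    rfl
  · rfl

/-- The doubled spins of a sequence of couplings of one qubit after the other, starting from no
qubits. -/
def IsCouplingPath {n : ℕ} (spin : Fin (n + 1) → ℕ) : Prop :=
  spin 0 = 0 ∧ ∀ r : Fin n, Step (spin r.castSucc) (spin r.succ)

lemma IsCouplingPath.init {n : ℕ} {spin : Fin (n + 2) → ℕ} (h : IsCouplingPath spin) :
    IsCouplingPath (Fin.init spin) :=
  ⟨h.1, fun r => h.2 r.castSucc⟩

lemma IsCouplingPath.step_last {n : ℕ} {spin : Fin (n + 2) → ℕ} (h : IsCouplingPath spin) :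
    Step (spin (Fin.last n).castSucc) (spin (Fin.last (n + 1))) :=
  h.2 (Fin.last n)

lemma isCouplingPath_succ {n : ℕ} {spin : Fin (n + 2) → ℕ} :
    IsCouplingPath spin ↔ IsCouplingPath (Fin.init spin) ∧
      Step (spin (Fin.last n).castSucc) (spin (Fin.last (n + 1))) :=
  ⟨fun h => ⟨h.init, h.step_last⟩, fun h => ⟨h.1.1, Fin.lastCases h.2 h.1.2⟩⟩

lemma isCouplingPath_of_schurKet_ne_zero {n : ℕ} {spin : Fin (n + 1) → ℕ} {m : ℤ}
    (h0 : spin 0 = 0) (h : schurKet n spin m ≠ 0) :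
    IsCouplingPath spin ∧ IsWeight (spin (Fin.last n)) m := by
  induction n generalizing m with
  | zero =>
    have hm : m = 0 := by
      by_contra hm
      refine h ?_
      ext x
      simp [schurKet, partialZ, firstQubits, Ne.symm hm]
    exact ⟨⟨h0, fun r => r.elim0⟩, by simp [hm, h0, IsWeight]⟩
  | succ n ih =>
    rw [schurKet_succ] at h
    obtain ⟨b, -, hb⟩ := Finset.exists_ne_zero_of_sum_ne_zero h
    obtain ⟨hcg, hket⟩ := smul_ne_zero_iff.mp hb
    obtain ⟨hpath, hm⟩ := ih (spin := Fin.init spin) h0 fun h => hket (by rw [h, map_zero])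
    have hcg : cg _ b _ m ≠ 0 := mod_cast hcg
    refine ⟨isCouplingPath_succ.mpr ⟨hpath, ?_⟩, hm.of_cg_ne_zero hcg⟩
    by_contra hstep
    exact hcg (cg_eq_zero_of_not_step hstep _ _)

lemma eq_iff_init_eq {n : ℕ} {spin spin' : Fin (n + 2) → ℕ} :
    spin = spin' ↔ Fin.init spin = Fin.init spin' ∧
      spin (Fin.last (n + 1)) = spin' (Fin.last (n + 1)) := by
  refine ⟨fun h => by simp [h], fun ⟨hi, hl⟩ => ?_⟩
  rw [← Fin.snoc_init_self spin, ← Fin.snoc_init_self spin', hi, hl]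

lemma inner_schurKet_succ {n : ℕ} (spin spin' : Fin (n + 2) → ℕ) (m m' : ℤ) :
    inner ℂ (schurKet (n + 1) spin m) (schurKet (n + 1) spin' m') =
      ∑ b, ((cg (spin (Fin.last n).castSucc) b (spin (Fin.last (n + 1))) m *
        cg (spin' (Fin.last n).castSucc) b (spin' (Fin.last (n + 1))) m' : ℝ) : ℂ) *
        inner ℂ (schurKet n (Fin.init spin) (m - twiceZ b))
          (schurKet n (Fin.init spin') (m' - twiceZ b)) := by
  simp only [schurKet_succ, sum_inner, inner_sum, inner_smul_left, inner_smul_right,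
    inner_appendQubit, Complex.conj_ofReal, Complex.ofReal_mul, mul_assoc]
  refine Finset.sum_congr rfl fun b _ => ?_
  rw [Finset.sum_eq_single b (fun c _ hc => by simp [hc]) (by simp), if_pos rfl, mul_left_comm]

lemma inner_schurKet {n : ℕ} {spin spin' : Fin (n + 1) → ℕ} {m m' : ℤ}
    (hs : IsCouplingPath spin) (hs' : IsCouplingPath spin')
    (hm : IsWeight (spin (Fin.last n)) m) (hm' : IsWeight (spin' (Fin.last n)) m') :
    inner ℂ (schurKet n spin m) (schurKet n spin' m') =
      if spin = spin' ∧ m = m' then 1 else 0 := by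
  induction n generalizing m m' with
  | zero =>
    obtain rfl : m = 0 := by simpa [hs.1] using hm.1
    obtain rfl : m' = 0 := by simpa [hs'.1] using hm'.1
    have hss : spin = spin' := funext fun i => by rw [Fin.fin_one_eq_zero i, hs.1, hs'.1]
    simp [schurKet, partialZ, firstQubits, hss, PiLp.inner_apply, -inner_self_eq_norm_sq_to_K]
  | succ n ih =>
    obtain ⟨hi, hstep⟩ := isCouplingPath_succ.mp hs
    obtain ⟨hi', hstep'⟩ := isCouplingPath_succ.mp hs'
    set c := fun b => cg (spin (Fin.last n).castSucc) b (spin (Fin.last (n + 1))) m *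
      cg (spin' (Fin.last n).castSucc) b (spin' (Fin.last (n + 1))) m' with hc
    have hterm (b : Fin 2) : (c b : ℂ) * inner ℂ (schurKet n (Fin.init spin) (m - twiceZ b))
          (schurKet n (Fin.init spin') (m' - twiceZ b)) =
        c b * if Fin.init spin = Fin.init spin' ∧ m = m' then 1 else 0 := by
      obtain h | h := eq_or_ne (c b) 0
      · rw [h, Complex.ofReal_zero, zero_mul, zero_mul]
      · rw [ih hi hi' (hm.sub_twiceZ_of_cg_ne_zero hstep (left_ne_zero_of_mul h))
          (hm'.sub_twiceZ_of_cg_ne_zero hstep' (right_ne_zero_of_mul h))]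
        simp only [sub_left_inj]
    rw [inner_schurKet_succ, Finset.sum_congr rfl fun b _ => hterm b, ← Finset.sum_mul,
      ← Complex.ofReal_sum]
    simp only [eq_iff_init_eq]
    by_cases heq : Fin.init spin = Fin.init spin' ∧ m = m'
    · obtain ⟨hinit, rfl⟩ := heq
      have hlast : spin' (Fin.last n).castSucc = spin (Fin.last n).castSucc :=
        congrFun hinit.symm (Fin.last n)
      rw [hlast] at hstep' hc
      rw [hc, sum_cg_mul_cg hstep hstep' hm hm']
      split_ifs <;> simp_all
    · rw [if_neg heq, mul_zero, if_neg fun h => heq ⟨h.1.1, h.2⟩]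

lemma SchurLabel.isCouplingPath {n : ℕ} (x : SchurLabel n) : IsCouplingPath x.spin :=
  ⟨x.spin_zero, x.spin_step⟩

lemma SchurLabel.isWeight {n : ℕ} (x : SchurLabel n) : IsWeight (x.spin (Fin.last n)) x.m :=
  ⟨x.m_range, x.m_parity⟩

lemma orthonormal_schurState {n : ℕ} : Orthonormal ℂ (schurState (n := n)) := by
  classical
  rw [orthonormal_iff_ite]
  intro x y
  simp only [schurState, inner_schurKet x.isCouplingPath y.isCouplingPath x.isWeight y.isWeight,
    SchurLabel.ext_iff]

lemma schurKet_mem_span {n : ℕ} {spin : Fin (n + 1) → ℕ} (h0 : spin 0 = 0) (m : ℤ) :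
    schurKet n spin m ∈ Submodule.span ℂ (Set.range (schurState (n := n))) := by
  by_cases h : schurKet n spin m = 0
  · rw [h]
    exact Submodule.zero_mem _
  obtain ⟨hpath, hm⟩ := isCouplingPath_of_schurKet_ne_zero h0 h
  exact Submodule.subset_span ⟨⟨spin, hpath.1, hpath.2, m, hm.1, hm.2⟩, rfl⟩

lemma appendQubit_schurKet {n : ℕ} {spin : Fin (n + 1) → ℕ} {m : ℤ}
    (hm : IsWeight (spin (Fin.last n)) m) (b : Fin 2) :
    appendQubit b (schurKet n spin m) =
      ∑ c ∈ {spin (Fin.last n) + 1, spin (Fin.last n) - 1},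
        (cg (spin (Fin.last n)) b c (m + twiceZ b) : ℂ) •
          schurKet (n + 1) (Fin.snoc (α := fun _ => ℕ) spin c) (m + twiceZ b) := by
  have hm' : IsWeight (spin (Fin.last n)) (m + twiceZ b - twiceZ b) := by
    rwa [add_sub_cancel_right]
  rw [Finset.sum_pair (by omega)]
  simp only [schurKet_succ, Fin.snoc_castSucc, Fin.snoc_last, Fin.init_snoc, Finset.smul_sum,
    smul_smul, ← Finset.sum_add_distrib, ← add_smul, ← Complex.ofReal_mul, ← Complex.ofReal_add,
    cg_mul_cg_up_add_down hm']
  rw [Finset.sum_eq_single b (fun c _ hc => by simp [hc.symm]) (by simp), if_pos rfl,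
    add_sub_cancel_right, Complex.ofReal_one, one_smul]

lemma span_schurState (n : ℕ) : Submodule.span ℂ (Set.range (schurState (n := n))) = ⊤ := by
  induction n with
  | zero =>
    refine Submodule.eq_top_iff'.mpr fun v => ?_
    have hv : v = v default • schurKet 0 (fun _ => 0) 0 := by
      ext x
      simp [schurKet, partialZ, firstQubits, Subsingleton.elim x default]
    rw [hv]
    exact Submodule.smul_mem _ _ (schurKet_mem_span rfl 0)
  | succ n ih =>
    have happend (b : Fin 2) (v : Qubits n) :
        appendQubit b v ∈ Submodule.span ℂ (Set.range (schurState (n := n + 1))) := by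
      have hv : v ∈ Submodule.span ℂ (Set.range (schurState (n := n))) := ih ▸ Submodule.mem_top
      induction hv using Submodule.span_induction with
      | mem v hv =>
        obtain ⟨x, rfl⟩ := hv
        rw [schurState, appendQubit_schurKet x.isWeight]
        exact Submodule.sum_mem _ fun c _ => Submodule.smul_mem _ _
          (schurKet_mem_span (by simpa [Fin.snoc] using x.spin_zero) _)
      | zero => simp
      | add v w _ _ hv hw => simpa using Submodule.add_mem _ hv hw
      | smul c v _ hv => simpa using Submodule.smul_mem _ c hv
    refine Submodule.eq_top_iff'.mpr fun v => ?_
    rw [eq_sum_appendQubit v]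
    exact Submodule.sum_mem _ fun b _ => happend b _

lemma isONB_schurState (n : ℕ) : IsONB (schurState (n := n)) :=
  ⟨orthonormal_schurState, span_schurState n⟩

/-! ### Exchange operators -/

section act

variable {n : ℕ}

lemma act_apply (A : Op n) (v : Qubits n) (x : Bits n) : act A v x = ∑ y, A x y * v y := rfl

lemma act_add (A : Op n) (v w : Qubits n) : act A (v + w) = act A v + act A w := map_add _ _ _

lemma act_sub (A : Op n) (v w : Qubits n) : act A (v - w) = act A v - act A w := map_sub _ _ _

lemma act_smul (A : Op n) (c : ℂ) (v : Qubits n) : act A (c • v) = c • act A v := map_smul _ _ _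

lemma act_zero (A : Op n) : act A 0 = 0 := map_zero _

lemma act_sum {ι : Type*} (A : Op n) (s : Finset ι) (v : ι → Qubits n) :
    act A (∑ i ∈ s, v i) = ∑ i ∈ s, act A (v i) := map_sum _ _ _

lemma add_act (A B : Op n) (v : Qubits n) : act (A + B) v = act A v + act B v := by
  simp [act]

lemma sub_act (A B : Op n) (v : Qubits n) : act (A - B) v = act A v - act B v := by
  simp [act]

lemma smul_act (c : ℂ) (A : Op n) (v : Qubits n) : act (c • A) v = c • act A v := by
  simp [act]

lemma one_act (v : Qubits n) : act (1 : Op n) v = v := by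
  simp [act, Matrix.toEuclideanLin]

lemma mul_act (A B : Op n) (v : Qubits n) : act (A * B) v = act A (act B v) := by
  simp [act, Matrix.toEuclideanLin]

lemma sum_act {ι : Type*} (s : Finset ι) (A : ι → Op n) (v : Qubits n) :
    act (∑ i ∈ s, A i) v = ∑ i ∈ s, act (A i) v := by
  simp [act]

lemma op_ext {A B : Op n} (h : ∀ v, act A v = act B v) : A = B :=
  Matrix.toEuclideanLin.injective (LinearMap.ext h)

end act

section swapOp

variable {n : ℕ}

lemma swapOp_act_apply (a b : Fin n) (v : Qubits n) (x : Bits n) :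
    act (swapOp a b) v x = v (x ∘ Equiv.swap a b) := by
  have hx (y : Bits n) : x = y ∘ Equiv.swap a b ↔ y = x ∘ Equiv.swap a b := by
    constructor <;> rintro rfl <;> funext i <;> simp
  simp [act_apply, swapOp, hx]

lemma swapOp_comm (a b : Fin n) : swapOp a b = swapOp b a := by
  simp only [swapOp, Equiv.swap_comm]

lemma swapOp_mul_self (a b : Fin n) : swapOp a b * swapOp a b = 1 := by
  refine op_ext fun v => PiLp.ext fun x => ?_
  rw [mul_act, one_act, swapOp_act_apply, swapOp_act_apply, Function.comp_assoc,
    ← Equiv.coe_trans, Equiv.swap_swap]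
  rfl

lemma swapOp_conj (a b c d : Fin n) :
    swapOp a b * swapOp c d * swapOp a b =
      swapOp (Equiv.swap a b c) (Equiv.swap a b d) := by
  refine op_ext fun v => PiLp.ext fun x => ?_
  rw [mul_act, mul_act, swapOp_act_apply, swapOp_act_apply, swapOp_act_apply, swapOp_act_apply,
    Equiv.swap_apply_apply, Equiv.swap_inv]
  rfl

lemma swapOp_conjTranspose (a b : Fin n) : (swapOp a b).conjTranspose = swapOp a b := by
  ext x y
  have : y = x ∘ Equiv.swap a b ↔ x = y ∘ Equiv.swap a b := by
    constructor <;> rintro rfl <;> funext i <;> simp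
  simp [swapOp, Matrix.conjTranspose_apply, this, apply_ite]

/-- The Jucys-Murphy element of qubit `r`: the sum of its exchanges with the preceding qubits. -/
def jucysMurphy (r : Fin n) : Op n := ∑ i with i < r, swapOp i r

lemma jucysMurphy_last (n : ℕ) :
    jucysMurphy (Fin.last n) = ∑ i : Fin n, swapOp i.castSucc (Fin.last n) := by
  simp [jucysMurphy, Finset.sum_filter, Fin.sum_univ_castSucc, Fin.castSucc_lt_last]

lemma jucysMurphy_castSucc (r : Fin n) :
    jucysMurphy r.castSucc = ∑ i with i < r, swapOp i.castSucc r.castSucc := by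
  simp [jucysMurphy, Finset.sum_filter, Fin.sum_univ_castSucc, (Fin.le_last _).not_gt]

/-- The exchange of the last two qubits. -/
def swapLast (n : ℕ) : Op (n + 2) := swapOp (Fin.last n).castSucc (Fin.last (n + 1))

lemma jucysMurphy_last_succ (n : ℕ) :
    jucysMurphy (Fin.last (n + 1)) =
      swapLast n * jucysMurphy (Fin.last n).castSucc * swapLast n + swapLast n := by
  rw [jucysMurphy_last, Fin.sum_univ_castSucc, jucysMurphy_castSucc, Finset.mul_sum,
    Finset.sum_mul, Finset.sum_filter, Fin.sum_univ_castSucc]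
  simp only [Fin.castSucc_lt_last, if_true, lt_self_iff_false, if_false, add_zero]
  congr 1
  refine Finset.sum_congr rfl fun i _ => ?_
  have h₁ : i.castSucc.castSucc ≠ (Fin.last n).castSucc := by
    simp [Fin.ext_iff, i.isLt.ne]
  have h₂ : i.castSucc.castSucc ≠ Fin.last (n + 1) := (Fin.castSucc_lt_last _).ne
  rw [swapLast, swapOp_conj, Equiv.swap_apply_left, Equiv.swap_apply_of_ne_of_ne h₁ h₂]

lemma swapLast_swapLast (v : Qubits (n + 2)) : act (swapLast n) (act (swapLast n) v) = v := by
  rw [← mul_act, swapLast, swapOp_mul_self, one_act]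

lemma snoc_comp_swap_castSucc (y : Bits n) (b : Fin 2) (i j : Fin n) :
    Fin.snoc (α := fun _ => Fin 2) y b ∘ Equiv.swap i.castSucc j.castSucc =
      Fin.snoc (α := fun _ => Fin 2) (y ∘ Equiv.swap i j) b := by
  funext l
  refine Fin.lastCases ?_ (fun l => ?_) l
  · simp [Equiv.swap_apply_of_ne_of_ne (Fin.castSucc_lt_last i).ne' (Fin.castSucc_lt_last j).ne']
  · rw [Function.comp_apply, ← Fin.coe_castSuccEmb, Function.Embedding.swap_apply]
    simp

lemma swapOp_castSucc_appendQubit (i j : Fin n) (b : Fin 2) (v : Qubits n) :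
    act (swapOp i.castSucc j.castSucc) (appendQubit b v) =
      appendQubit b (act (swapOp i j) v) :=
  ext_snoc fun y c => by
    rw [swapOp_act_apply, snoc_comp_swap_castSucc, appendQubit_snoc, appendQubit_snoc,
      swapOp_act_apply]

lemma jucysMurphy_castSucc_appendQubit (r : Fin n) (b : Fin 2) (v : Qubits n) :
    act (jucysMurphy r.castSucc) (appendQubit b v) =
      appendQubit b (act (jucysMurphy r) v) := by
  rw [jucysMurphy_castSucc, jucysMurphy, sum_act, sum_act, map_sum]
  simp only [swapOp_castSucc_appendQubit]

lemma swapLast_appendQubit (b c : Fin 2) (v : Qubits n) :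
    act (swapLast n) (appendQubit b (appendQubit c v)) = appendQubit c (appendQubit b v) := by
  refine ext_snoc fun y d => ?_
  obtain ⟨y, e, rfl⟩ : ∃ z e, y = Fin.snoc (α := fun _ => Fin 2) z e :=
    ⟨Fin.init y, y (Fin.last n), (Fin.snoc_init_self y).symm⟩
  have hswap : Fin.snoc (α := fun _ => Fin 2) (Fin.snoc (α := fun _ => Fin 2) y e) d ∘
      Equiv.swap (Fin.last n).castSucc (Fin.last (n + 1)) =
        Fin.snoc (α := fun _ => Fin 2) (Fin.snoc (α := fun _ => Fin 2) y d) e := by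
    funext l
    refine Fin.lastCases ?_ (Fin.lastCases ?_ fun l => ?_) l
    · simp
    · simp
    · rw [Function.comp_apply, Equiv.swap_apply_of_ne_of_ne
        (by simp [Fin.ext_iff, l.isLt.ne]) (Fin.castSucc_lt_last _).ne]
      simp
  rw [swapLast, swapOp_act_apply, hswap]
  simp only [appendQubit_snoc]
  split_ifs <;> rfl

end swapOp

/-! ### Schur states and exchanges -/

section coupling

variable {n : ℕ} {spin : Fin (n + 3) → ℕ}

lemma schurKet_add_two (spin : Fin (n + 3) → ℕ) (m : ℤ) :
    schurKet (n + 2) spin m = ∑ y, ∑ x,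
      (cgPair (spin (Fin.last n).castSucc.castSucc) (spin (Fin.last (n + 1)).castSucc)
        (spin (Fin.last (n + 2))) m x y : ℂ) •
        appendQubit y (appendQubit x
          (schurKet n (Fin.init (Fin.init spin)) (m - twiceZ y - twiceZ x))) := by
  rw [schurKet_succ]
  refine Finset.sum_congr rfl fun y _ => ?_
  rw [schurKet_succ, map_sum, Finset.smul_sum]
  refine Finset.sum_congr rfl fun x _ => ?_
  rw [map_smul, smul_smul, cgPair, Complex.ofReal_mul, mul_comm]
  rfl

lemma swapLast_schurKet (spin : Fin (n + 3) → ℕ) (m : ℤ) :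
    act (swapLast n) (schurKet (n + 2) spin m) = ∑ y, ∑ x,
      (cgPair (spin (Fin.last n).castSucc.castSucc) (spin (Fin.last (n + 1)).castSucc)
        (spin (Fin.last (n + 2))) m y x : ℂ) •
        appendQubit y (appendQubit x
          (schurKet n (Fin.init (Fin.init spin)) (m - twiceZ y - twiceZ x))) := by
  rw [schurKet_add_two, Finset.sum_comm]
  simp only [act_sum, act_smul, swapLast_appendQubit, sub_right_comm m]

/-- The vector `√2 (v ⊗ |ψ⁻⟩)`. -/
def appendSinglet (v : Qubits n) : Qubits (n + 2) :=
  appendQubit 1 (appendQubit 0 v) - appendQubit 0 (appendQubit 1 v)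

lemma IsCouplingPath.step_penultimate (h : IsCouplingPath spin) :
    Step (spin (Fin.last n).castSucc.castSucc) (spin (Fin.last (n + 1)).castSucc) :=
  h.init.step_last

lemma swapLast_schurKet_of_ne {m : ℤ} (h0 : spin 0 = 0)
    (hks : spin (Fin.last n).castSucc.castSucc ≠ spin (Fin.last (n + 2))) :
    act (swapLast n) (schurKet (n + 2) spin m) = schurKet (n + 2) spin m := by
  by_cases hket : schurKet (n + 2) spin m = 0
  · rw [hket, act_zero]
  obtain ⟨h, hm⟩ := isCouplingPath_of_schurKet_ne_zero h0 hket
  rw [swapLast_schurKet, schurKet_add_two]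
  simp only [cgPair_comm h.step_penultimate h.step_last hks hm]

lemma schurKet_sub_swapLast {a : ℕ} {m : ℤ} (h : IsCouplingPath spin) (hm : IsWeight a m)
    (hk : spin (Fin.last n).castSucc.castSucc = a) (hs : spin (Fin.last (n + 2)) = a) :
    schurKet (n + 2) spin m - act (swapLast n) (schurKet (n + 2) spin m) =
      (singletAmp a (spin (Fin.last (n + 1)).castSucc) : ℂ) •
        appendSinglet (schurKet n (Fin.init (Fin.init spin)) m) := by
  have hstep := h.step_penultimate
  rw [hk] at hstep
  rw [swapLast_schurKet, schurKet_add_two, hk, hs, ← cgPair_sub_cgPair hstep hm]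
  simp only [Fin.sum_univ_two, appendSinglet, twiceZ, if_true, one_ne_zero, if_false,
    sub_neg_eq_add, sub_add_cancel, add_sub_cancel_right, Complex.ofReal_sub]
  module

lemma appendSinglet_schurKet {a : ℕ} {m : ℤ} (hm : IsWeight a m)
    (hk : spin (Fin.last n).castSucc.castSucc = a) (hs : spin (Fin.last (n + 2)) = a) :
    appendSinglet (schurKet n (Fin.init (Fin.init spin)) m) =
      (singletAmp a (a + 1) : ℂ) •
        schurKet (n + 2) (Function.update spin (Fin.last (n + 1)).castSucc (a + 1)) m +
      (singletAmp a (a - 1) : ℂ) •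
        schurKet (n + 2) (Function.update spin (Fin.last (n + 1)).castSucc (a - 1)) m := by
  have hinit (b : ℕ) :
      Fin.init (Fin.init (Function.update spin (Fin.last (n + 1)).castSucc b)) =
        Fin.init (Fin.init spin) := by
    rw [Fin.init_update_castSucc, Fin.init_update_last]
  have hk' (b : ℕ) : Function.update spin (Fin.last (n + 1)).castSucc b
      (Fin.last n).castSucc.castSucc = a := by
    rw [Function.update_of_ne (by simp [Fin.ext_iff]), hk]
  have hs' (b : ℕ) : Function.update spin (Fin.last (n + 1)).castSucc b (Fin.last (n + 2)) = a := by
    rw [Function.update_of_ne (Fin.castSucc_lt_last _).ne', hs]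
  have hcoeff (x y : Fin 2) : (singletAmp a (a + 1) : ℂ) * cgPair a (a + 1) a m x y +
      singletAmp a (a - 1) * cgPair a (a - 1) a m x y = (twiceZ x - twiceZ y) / 2 := by
    exact_mod_cast congrArg Complex.ofReal (sum_singletAmp_mul_cgPair hm x y)
  simp only [schurKet_add_two, hinit, hk', hs', Function.update_self, Finset.smul_sum, smul_smul,
    ← Finset.sum_add_distrib, ← add_smul, hcoeff]
  simp [Fin.sum_univ_two, appendSinglet, twiceZ]
  module

lemma update_zero_of_zero (h0 : spin 0 = 0) (b : ℕ) :
    Function.update spin (Fin.last (n + 1)).castSucc b 0 = 0 := by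
  rw [Function.update_of_ne (by simp [Fin.ext_iff]), h0]

end coupling

/-- The content of the box added to the Young diagram with rows `(r + a) / 2 ≥ (r - a) / 2` by the
step of the doubled spin from `a` to `b`: the eigenvalue of the Jucys-Murphy element of qubit `r`
on the states with this step. -/
def content (a b r : ℕ) : ℝ := if b = a + 1 then ((a : ℝ) + r) / 2 else ((r : ℝ) - a - 2) / 2

lemma content_up (a r : ℕ) : content a (a + 1) r = ((a : ℝ) + r) / 2 := if_pos rfl

lemma content_down (a r : ℕ) : content a (a - 1) r = ((r : ℝ) - a - 2) / 2 := if_neg (by omega)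

lemma content_succ_left (a r : ℕ) : content (a + 1) a r = ((r : ℝ) - a - 3) / 2 := by
  rw [content, if_neg (by omega)]
  push_cast
  ring

lemma content_add_two {k j s : ℕ} (r : ℕ) (hkj : Step k j) (hjs : Step j s) (hks : k ≠ s) :
    content j s (r + 1) = content k j r + 1 := by
  rcases hkj with rfl | rfl <;> rcases hjs with rfl | hjs
  · rw [content_up, content_up]
    push_cast
    ring
  · omega
  · omega
  · subst hjs
    rw [content_succ_left, content_succ_left]
    push_cast
    ring

-- Young's orthogonal form: on the span of the two states that differ in `j` only, the Jucys-Murphy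
-- element of the last but one qubit is diagonal and the exchange is a reflection.
lemma jucysMurphy_swapLast_schurKet {n a : ℕ} {spin : Fin (n + 3) → ℕ} {m : ℤ}
    (h : IsCouplingPath spin) (hm : IsWeight a m)
    (hk : spin (Fin.last n).castSucc.castSucc = a) (hs : spin (Fin.last (n + 2)) = a)
    (hX : ∀ b, act (jucysMurphy (Fin.last n).castSucc)
      (schurKet (n + 2) (Function.update spin (Fin.last (n + 1)).castSucc b) m) =
        (content a b n : ℂ) •
          schurKet (n + 2) (Function.update spin (Fin.last (n + 1)).castSucc b) m) :
    act (jucysMurphy (Fin.last n).castSucc) (act (swapLast n) (schurKet (n + 2) spin m)) +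
        schurKet (n + 2) spin m =
      (content (spin (Fin.last (n + 1)).castSucc) a (n + 1) : ℂ) •
        act (swapLast n) (schurKet (n + 2) spin m) := by
  have hup : (singletAmp a (a + 1) : ℂ) ^ 2 * (a + 1) = a + 2 := by
    have := singletAmp_up_sq a
    field_simp at this
    exact_mod_cast this
  have hdown : (singletAmp a (a - 1) : ℂ) ^ 2 * (a + 1) = a := by
    have := singletAmp_down_sq a
    field_simp at this
    exact_mod_cast this
  have hswap := sub_eq_iff_eq_add.mp (schurKet_sub_swapLast h hm hk hs)
  rw [appendSinglet_schurKet hm hk hs, ← sub_eq_iff_eq_add'] at hswap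
  have hX' := hX (spin (Fin.last (n + 1)).castSucc)
  rw [Function.update_eq_self] at hX'
  rw [← hswap, act_sub, act_smul, act_add, act_smul, act_smul, hX, hX, hX']
  have hstep := h.step_penultimate
  rw [hk] at hstep
  rcases hstep with hj | hj
  · have hself : Function.update spin (Fin.last (n + 1)).castSucc (a + 1) = spin := by
      rw [← hj, Function.update_eq_self]
    simp only [hself, hj, content_up, content_down, content_succ_left, Nat.cast_add, Nat.cast_one]
    push_cast
    linear_combination (norm := module) (-1 : ℂ) • congrArg (· • schurKet (n + 2) spin m) hup
  · have hself : Function.update spin (Fin.last (n + 1)).castSucc (a - 1) = spin := by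
      rw [hj, Nat.add_sub_cancel, Function.update_eq_self]
    generalize spin (Fin.last (n + 1)).castSucc = j at *
    subst hj
    rw [Nat.add_sub_cancel] at hself hdown
    push_cast at hdown
    simp only [hself, Nat.add_sub_cancel, content_up, content_succ_left, Nat.cast_add, Nat.cast_one]
    push_cast
    linear_combination (norm := module) congrArg (· • schurKet (n + 2) spin m) hdown

lemma jucysMurphy_schurKet {n : ℕ} {spin : Fin (n + 1) → ℕ} (h0 : spin 0 = 0) (r : Fin n)
    (m : ℤ) :
    act (jucysMurphy r) (schurKet n spin m) =
      (content (spin r.castSucc) (spin r.succ) r : ℂ) • schurKet n spin m := by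
  induction n generalizing m with
  | zero => exact r.elim0
  | succ n ih =>
    have hinit (r : Fin n) {spin : Fin (n + 2) → ℕ} (h0 : spin 0 = 0) :
        act (jucysMurphy r.castSucc) (schurKet (n + 1) spin m) =
          (content (spin r.castSucc.castSucc) (spin r.castSucc.succ) r : ℂ) •
            schurKet (n + 1) spin m := by
      simp only [schurKet_succ, act_sum, act_smul, jucysMurphy_castSucc_appendQubit,
        ih (spin := Fin.init spin) h0, map_smul, Finset.smul_sum]
      exact Finset.sum_congr rfl fun b _ => smul_comm _ _ _
    refine Fin.lastCases ?_ (fun r => hinit r h0) r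
    by_cases hket : schurKet (n + 1) spin m = 0
    · rw [hket, act_zero, smul_zero]
    obtain ⟨h, hm⟩ := isCouplingPath_of_schurKet_ne_zero h0 hket
    obtain _ | n := n
    · have h1 : spin 1 = 1 := by simpa [Step, h0] using h.2 0
      simp [jucysMurphy, act, content, h0, h1]
    rw [jucysMurphy_last_succ, add_act, mul_act, mul_act]
    by_cases hks : spin (Fin.last n).castSucc.castSucc = spin (Fin.last (n + 2))
    · rw [← act_add, jucysMurphy_swapLast_schurKet h hm hks rfl, act_smul, swapLast_swapLast]
      · rfl
      intro b
      rw [hinit _ (update_zero_of_zero h0 b), Fin.succ_castSucc, Fin.succ_last,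
        Function.update_self, Function.update_of_ne (by simp [Fin.ext_iff]), hks]
      rfl
    · rw [swapLast_schurKet_of_ne h0 hks, hinit _ h0, act_smul, swapLast_schurKet_of_ne h0 hks]
      rw [Fin.val_last, Fin.val_last, Fin.succ_castSucc, Fin.succ_last, Fin.succ_last,
        content_add_two n h.step_penultimate h.step_last hks]
      push_cast
      module

/-! ### Spin operators -/

section spin

variable {n : ℕ}

lemma onQubit_act_apply (i : Fin n) (P : Matrix (Fin 2) (Fin 2) ℂ) (v : Qubits n) (x : Bits n) :
    act (onQubit i P) v x = ∑ b, P (x i) b * v (Function.update x i b) := by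
  rw [act_apply]
  refine (Finset.sum_of_injOn (Function.update x i) (Function.update_injective x i).injOn
    (fun _ _ => Finset.mem_coe.mpr (Finset.mem_univ _)) (fun y _ hy => ?_) fun b _ => ?_).symm
  · rw [onQubit, Matrix.of_apply, if_neg, zero_mul]
    refine fun h => hy ⟨y i, by simp, ?_⟩
    exact Function.update_eq_iff.mpr ⟨rfl, h⟩
  · rw [onQubit, Matrix.of_apply, if_pos fun l hl => (Function.update_of_ne hl _ _).symm,
      Function.update_self]

lemma comp_swap_eq_update (x : Bits n) {i j : Fin n} (h : i ≠ j) :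
    x ∘ Equiv.swap i j = Function.update (Function.update x i (x j)) j (x i) := by
  rw [Equiv.comp_swap_eq_update, Function.update_comm h]

lemma sum_pauli_mul_pauli (p q r s : Fin 2) :
    ∑ c, pauli c p q * pauli c r s =
      2 * (if s = p ∧ q = r then 1 else 0) - if q = p ∧ s = r then 1 else 0 := by
  fin_cases p <;> fin_cases q <;> fin_cases r <;> fin_cases s <;>
    simp [Fin.sum_univ_three, pauli] <;> norm_num

lemma sum_onQubit_pauli_mul_of_ne {i j : Fin n} (h : i ≠ j) :
    ∑ c, onQubit i (pauli c) * onQubit j (pauli c) = (2 : ℂ) • swapOp i j - 1 := by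
  refine op_ext fun v => PiLp.ext fun x => ?_
  have hsum : act (∑ c, onQubit i (pauli c) * onQubit j (pauli c)) v x =
      ∑ b, ∑ b', (∑ c, pauli c (x i) b * pauli c (x j) b') *
        v (Function.update (Function.update x i b) j b') := by
    simp only [sum_act, WithLp.ofLp_sum, Finset.sum_apply, mul_act, onQubit_act_apply,
      Function.update_of_ne h.symm, Finset.mul_sum, Finset.sum_mul, mul_assoc]
    rw [Finset.sum_comm]
    exact Finset.sum_congr rfl fun b _ => Finset.sum_comm
  rw [hsum, sub_act, smul_act, one_act, PiLp.sub_apply, PiLp.smul_apply, swapOp_act_apply,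
    comp_swap_eq_update x h]
  simp only [sum_pauli_mul_pauli, sub_mul, Finset.sum_sub_distrib, mul_assoc, ← Finset.mul_sum]
  simp [-Fin.sum_univ_two, ite_and]

lemma sum_onQubit_pauli_mul_self (i : Fin n) :
    ∑ c, onQubit i (pauli c) * onQubit i (pauli c) = (3 : ℂ) • (1 : Op n) := by
  refine op_ext fun v => PiLp.ext fun x => ?_
  have hsum : act (∑ c, onQubit i (pauli c) * onQubit i (pauli c)) v x =
      ∑ b, ∑ b', (∑ c, pauli c (x i) b * pauli c b b') * v (Function.update x i b') := by
    simp only [sum_act, WithLp.ofLp_sum, Finset.sum_apply, mul_act, onQubit_act_apply,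
      Function.update_self, Function.update_idem, Finset.mul_sum, Finset.sum_mul, mul_assoc]
    rw [Finset.sum_comm]
    exact Finset.sum_congr rfl fun b _ => Finset.sum_comm
  rw [hsum, smul_act, one_act, PiLp.smul_apply]
  simp only [sum_pauli_mul_pauli, sub_mul, Finset.sum_sub_distrib, mul_assoc, ← Finset.mul_sum]
  simp [-Fin.sum_univ_two, ite_and]
  ring

lemma sum_spinComp_mul (a b : Finset (Fin n)) :
    ∑ c, spinComp a c * spinComp b c =
      ∑ i ∈ a, ∑ j ∈ b, (1 / 4 : ℂ) • ∑ c, onQubit i (pauli c) * onQubit j (pauli c) := by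
  simp only [spinComp, Finset.sum_mul_sum, Finset.smul_sum]
  rw [Finset.sum_comm]
  refine Finset.sum_congr rfl fun i _ => ?_
  rw [Finset.sum_comm]
  refine Finset.sum_congr rfl fun j _ => Finset.sum_congr rfl fun c _ => ?_
  rw [smul_mul_smul_comm]
  norm_num

lemma sum_spinComp_mul_of_disjoint {a b : Finset (Fin n)} (h : Disjoint a b) :
    ∑ c, spinComp a c * spinComp b c =
      ∑ i ∈ a, ∑ j ∈ b, ((1 / 2 : ℂ) • swapOp i j - (1 / 4 : ℂ) • 1) := by
  rw [sum_spinComp_mul]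
  refine Finset.sum_congr rfl fun i hi => Finset.sum_congr rfl fun j hj => ?_
  rw [sum_onQubit_pauli_mul_of_ne (Finset.disjoint_iff_ne.mp h i hi j hj)]
  module

lemma totalSpin_singleton (i : Fin n) : totalSpin {i} = (3 / 4 : ℂ) • (1 : Op n) := by
  rw [totalSpin, sum_spinComp_mul, Finset.sum_singleton, Finset.sum_singleton,
    sum_onQubit_pauli_mul_self, smul_smul]
  norm_num

lemma totalSpin_insert {a : Finset (Fin n)} {r : Fin n} (h : r ∉ a) :
    totalSpin (insert r a) =
      totalSpin a + ((3 / 4 : ℂ) - a.card / 2) • (1 : Op n) + ∑ i ∈ a, swapOp i r := by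
  have hadd (c : Fin 3) : spinComp (insert r a) c = spinComp a c + spinComp {r} c := by
    rw [spinComp, spinComp, spinComp, Finset.sum_insert h, Finset.sum_singleton, add_comm]
  have hr : Disjoint a {r} := Finset.disjoint_singleton_right.mpr h
  have hcross := sum_spinComp_mul_of_disjoint hr
  have hcross' := sum_spinComp_mul_of_disjoint hr.symm
  have hself := totalSpin_singleton r
  simp only [Finset.sum_singleton, Finset.sum_sub_distrib, ← Finset.smul_sum, Finset.sum_const,
    Finset.card_singleton, one_smul, swapOp_comm r, ← Nat.cast_smul_eq_nsmul ℂ a.card]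
    at hcross hcross'
  rw [totalSpin] at hself
  simp only [totalSpin, hadd, mul_add, add_mul, Finset.sum_add_distrib, hcross, hcross', hself]
  module

lemma firstQubits_zero : firstQubits (0 : Fin (n + 1)) = ∅ := by
  simp [firstQubits]

lemma firstQubits_castSucc (r : Fin n) : firstQubits r.castSucc = Finset.Iio r := by
  ext i
  simp [firstQubits]

lemma firstQubits_succ (r : Fin n) :
    firstQubits r.succ = insert r (firstQubits r.castSucc) := by
  ext i
  simp [firstQubits, le_iff_eq_or_lt, Fin.val_inj]

lemma totalSpin_firstQubits_succ (r : Fin n) :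
    totalSpin (firstQubits r.succ) =
      totalSpin (firstQubits r.castSucc) + ((3 / 4 : ℂ) - r / 2) • (1 : Op n) + jucysMurphy r := by
  rw [firstQubits_succ, totalSpin_insert (by simp [firstQubits]), firstQubits_castSucc,
    Fin.card_Iio, jucysMurphy, Finset.filter_gt_eq_Iio]

lemma totalSpin_schurKet {spin : Fin (n + 1) → ℕ} (h : IsCouplingPath spin) (r : Fin (n + 1))
    (m : ℤ) :
    act (totalSpin (firstQubits r)) (schurKet n spin m) =
      ((spin r : ℂ) / 2 * ((spin r : ℂ) / 2 + 1)) • schurKet n spin m := by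
  induction r using Fin.induction with
  | zero => simp [firstQubits_zero, totalSpin, spinComp, act, h.1]
  | succ r ih =>
    rw [totalSpin_firstQubits_succ, add_act, add_act, ih, smul_act, one_act,
      jucysMurphy_schurKet h.1, ← add_smul, ← add_smul]
    congr 1
    rcases h.2 r with hr | hr
    · rw [hr, content_up]
      push_cast
      ring
    · rw [hr, content_succ_left]
      push_cast
      ring

lemma spinComp_univ_two_act_apply (v : Qubits n) (x : Bits n) :
    act (spinComp Finset.univ 2) v x = (partialZ x (Fin.last n) : ℂ) / 2 * v x := by
  have hfirst : firstQubits (Fin.last n) = Finset.univ := by simp [firstQubits]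
  have hpauli (i : Fin n) : act (onQubit i (pauli 2)) v x = twiceZ (x i) * v x := by
    have hx : v x = v (Function.update x i (x i)) := by rw [Function.update_eq_self]
    rw [onQubit_act_apply, hx]
    generalize x i = b
    fin_cases b <;> simp [pauli, twiceZ]
  simp only [spinComp, sum_act, smul_act, WithLp.ofLp_sum, Finset.sum_apply, PiLp.smul_apply,
    hpauli, partialZ, hfirst, smul_eq_mul, Int.cast_sum, Finset.sum_div, Finset.sum_mul]
  exact Finset.sum_congr rfl fun i _ => by ring

lemma spinComp_univ_two_schurKet (spin : Fin (n + 1) → ℕ) (m : ℤ) :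
    act (spinComp Finset.univ 2) (schurKet n spin m) = ((m : ℂ) / 2) • schurKet n spin m := by
  ext x
  rw [spinComp_univ_two_act_apply, PiLp.smul_apply, smul_eq_mul]
  by_cases hx : partialZ x (Fin.last n) = m
  · rw [hx]
  · simp [schurKet, hx]

lemma isSpinEigenbasis_schurState (n : ℕ) : IsSpinEigenbasis (schurState (n := n)) :=
  ⟨isONB_schurState n, fun x r => totalSpin_schurKet x.isCouplingPath r x.m,
    fun x => spinComp_univ_two_schurKet x.spin x.m⟩

end spin

/-! ### The square-root measurement -/

section functionalCalculus

variable {n : ℕ} {A : Op n} {v : Qubits n} {t : ℝ}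

lemma act_aeval (hv : act A v = (t : ℂ) • v) (p : Polynomial ℝ) :
    act (Polynomial.aeval A p) v = ((p.eval t : ℝ) : ℂ) • v := by
  induction p using Polynomial.induction_on with
  | C a =>
    rw [Polynomial.aeval_C, Polynomial.eval_C, Algebra.algebraMap_eq_smul_one, ← Complex.coe_smul,
      smul_act, one_act]
  | add p q hp hq => simp [add_act, hp, hq, add_smul]
  | monomial k a h =>
    rw [pow_succ, ← mul_assoc, map_mul, Polynomial.aeval_X, mul_act, hv, act_smul, h, smul_smul,
      Polynomial.eval_mul_X, Complex.ofReal_mul, mul_comm]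

lemma act_cfc (hA : A.IsHermitian) (f : ℝ → ℝ) (hv : act A v = (t : ℂ) • v) :
    act (cfc f A) v = (f t : ℂ) • v := by
  classical
  set nodes : Finset ℝ := insert t A.finite_real_spectrum.toFinset
  set p : Polynomial ℝ := Lagrange.interpolate nodes id f
  have hp {x : ℝ} (hx : x ∈ nodes) : p.eval x = f x :=
    Lagrange.eval_interpolate_at_node f Function.injective_id.injOn hx
  have hcfc : cfc f A = Polynomial.aeval A p := by
    rw [← cfc_polynomial p A hA.isSelfAdjoint]
    exact cfc_congr fun x hx => (hp (by simp [nodes, hx])).symm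
  rw [hcfc, act_aeval hv, hp (Finset.mem_insert_self _ _)]

end functionalCalculus

lemma singlet_mul_star (a b c d : Fin 2) :
    singlet a b * star (singlet c d) =
      (1 / 2 : ℂ) * ((if a = c ∧ b = d then 1 else 0) - (if a = d ∧ b = c then 1 else 0)) := by
  have h : (((√2 : ℝ) : ℂ))⁻¹ * ((√2 : ℝ) : ℂ)⁻¹ = 1 / 2 := by
    rw [← mul_inv, ← Complex.ofReal_mul, Real.mul_self_sqrt (by norm_num)]
    norm_num
  fin_cases a <;> fin_cases b <;> fin_cases c <;> fin_cases d <;> simp [singlet] <;>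
    simpa using h

lemma funext_iff_of_forall_ne {ι α : Type*} {a b : ι} {x y : ι → α}
    (h : ∀ l, l ≠ a → l ≠ b → x l = y l) : x = y ↔ x a = y a ∧ x b = y b := by
  refine ⟨fun hxy => by simp [hxy], fun ⟨ha, hb⟩ => funext fun l => ?_⟩
  by_cases hla : l = a
  · rw [hla, ha]
  · by_cases hlb : l = b
    · rw [hlb, hb]
    · exact h l hla hlb

lemma sigma_eq {N : ℕ} (i : Fin N) :
    sigma N i = ((1 : ℂ) / 2 ^ N) • (1 - swapOp i.castSucc (Fin.last N)) := by
  obtain _ | N := N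
  · exact i.elim0
  ext x y
  simp only [sigma, Matrix.smul_apply, Matrix.of_apply, Matrix.sub_apply, Matrix.one_apply,
    swapOp, smul_eq_mul, singlet_mul_star, Nat.add_sub_cancel]
  by_cases h : ∀ l, l ≠ i.castSucc → l ≠ Fin.last (N + 1) → x l = y l
  · have h' : ∀ l, l ≠ i.castSucc → l ≠ Fin.last (N + 1) →
        x l = (y ∘ Equiv.swap i.castSucc (Fin.last (N + 1))) l := fun l hi hl => by
      rw [h l hi hl, Function.comp_apply, Equiv.swap_apply_of_ne_of_ne hi hl]
    simp only [if_pos h, funext_iff_of_forall_ne h, funext_iff_of_forall_ne h', Function.comp_apply,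
      Equiv.swap_apply_left, Equiv.swap_apply_right, pow_succ]
    ring
  · have hid : x ≠ y := fun hxy => h fun l _ _ => congrFun hxy l
    have hswap : x ≠ y ∘ Equiv.swap i.castSucc (Fin.last (N + 1)) := fun hxy =>
      h fun l hi hl => by rw [hxy, Function.comp_apply, Equiv.swap_apply_of_ne_of_ne hi hl]
    rw [if_neg h, if_neg hid, if_neg hswap, sub_zero, mul_zero,
      mul_zero]

lemma rho_eq (N : ℕ) :
    rho N = ((1 : ℂ) / 2 ^ N) • ((N : ℂ) • 1 - jucysMurphy (Fin.last N)) := by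
  simp only [rho, sigma_eq, ← Finset.smul_sum, Finset.sum_sub_distrib, jucysMurphy_last]
  simp [Nat.cast_smul_eq_nsmul]

lemma sigma_isHermitian {N : ℕ} (i : Fin N) : (sigma N i).IsHermitian := by
  rw [sigma_eq, Matrix.IsHermitian, Matrix.conjTranspose_smul, Matrix.conjTranspose_sub,
    Matrix.conjTranspose_one, swapOp_conjTranspose]
  simp

lemma rho_isHermitian (N : ℕ) : (rho N).IsHermitian := by
  rw [Matrix.IsHermitian, rho, Matrix.conjTranspose_sum]
  exact Finset.sum_congr rfl fun i _ => sigma_isHermitian i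

/-- The eigenvalue of `ρ` on the Schur states whose last coupling goes from spin `j / 2` to spin
`s / 2`: `λ⁻` if the spin goes up, `λ⁺` if it goes down. -/
def rhoEig (N j s : ℕ) : ℝ := if s = j + 1 then lamMinus N (j / 2) else lamPlus N (j / 2)

lemma rhoEig_up (N j : ℕ) : rhoEig N j (j + 1) = lamMinus N (j / 2) := if_pos rfl

lemma rhoEig_succ_left (N s : ℕ) : rhoEig N (s + 1) s = lamPlus N ((s + 1) / 2) := by
  rw [rhoEig, if_neg (by omega), Nat.cast_add_one]

lemma rhoEig_eq_content (N j s : ℕ) : rhoEig N j s = 1 / 2 ^ N * ((N : ℝ) - content j s N) := by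
  rw [rhoEig, content, lamMinus, lamPlus]
  split_ifs <;> ring

lemma IsCouplingPath.le {n : ℕ} {spin : Fin (n + 1) → ℕ} (h : IsCouplingPath spin)
    (r : Fin (n + 1)) : spin r ≤ r := by
  induction r using Fin.induction with
  | zero => simp [h.1]
  | succ r ih =>
    have := h.2 r
    rw [Step] at this
    rw [Fin.val_castSucc] at ih
    rw [Fin.val_succ]
    omega

section schurKet

variable {N : ℕ} {spin : Fin (N + 2) → ℕ}

lemma rho_schurKet (h0 : spin 0 = 0) (m : ℤ) :
    act (rho N) (schurKet (N + 1) spin m) =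
      (rhoEig N (spin (Fin.last N).castSucc) (spin (Fin.last (N + 1))) : ℂ) •
        schurKet (N + 1) spin m := by
  rw [rho_eq, smul_act, sub_act, smul_act, one_act, jucysMurphy_schurKet h0, ← sub_smul, smul_smul,
    rhoEig_eq_content]
  push_cast
  rfl

lemma rhoEig_eq_zero (h : IsCouplingPath spin) (hs : spin (Fin.last (N + 1)) = N + 1) :
    rhoEig N (spin (Fin.last N).castSucc) (spin (Fin.last (N + 1))) = 0 := by
  have hle := h.le (Fin.last N).castSucc
  have hstep := h.step_last
  rw [Step] at hstep
  rw [Fin.val_castSucc, Fin.val_last] at hle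
  rw [hs, show spin (Fin.last N).castSucc = N by omega, rhoEig_up, lamMinus, sub_self, mul_zero]

lemma rhoEig_pos (h : IsCouplingPath spin) (hs : spin (Fin.last (N + 1)) ≠ N + 1) :
    0 < rhoEig N (spin (Fin.last N).castSucc) (spin (Fin.last (N + 1))) := by
  have hle := h.le (Fin.last N).castSucc
  rw [Fin.val_castSucc, Fin.val_last] at hle
  rcases h.step_last with hup | hdown
  · have hlt : (spin (Fin.last N).castSucc : ℝ) < N := by
      exact_mod_cast (by omega : spin (Fin.last N).castSucc < N)
    rw [hup, rhoEig_up, lamMinus]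
    exact mul_pos (by positivity) (by linarith)
  · rw [hdown, rhoEig_succ_left, lamPlus]
    positivity

lemma rhoInvSqrt_schurKet (h0 : spin 0 = 0) (m : ℤ) :
    act (rhoInvSqrt N) (schurKet (N + 1) spin m) =
      (((√(rhoEig N (spin (Fin.last N).castSucc) (spin (Fin.last (N + 1)))))⁻¹ : ℝ) : ℂ) •
        schurKet (N + 1) spin m :=
  act_cfc (rho_isHermitian N) _ (rho_schurKet h0 m)

lemma excess_eq (N : ℕ) :
    excess N = ((1 : ℂ) / N) • (1 - rhoInvSqrt N * rho N * rhoInvSqrt N) := by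
  rw [excess, rho, Finset.mul_sum, Finset.sum_mul]

lemma excess_schurKet (h0 : spin 0 = 0) (m : ℤ) :
    act (excess N) (schurKet (N + 1) spin m) =
      ((if spin (Fin.last (N + 1)) = N + 1 then 1 / N else 0 : ℝ) : ℂ) •
        schurKet (N + 1) spin m := by
  by_cases hket : schurKet (N + 1) spin m = 0
  · rw [hket, act_zero, smul_zero]
  have h := (isCouplingPath_of_schurKet_ne_zero h0 hket).1
  rw [excess_eq, smul_act, sub_act, one_act, mul_act, mul_act, rhoInvSqrt_schurKet h0, act_smul,
    rho_schurKet h0, act_smul, act_smul, rhoInvSqrt_schurKet h0, smul_smul, smul_smul,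
    ← Complex.ofReal_mul, ← Complex.ofReal_mul]
  split_ifs with hs
  · simp [rhoEig_eq_zero h hs]
  · have hpos := rhoEig_pos h hs
    rw [mul_right_comm, ← mul_inv, Real.mul_self_sqrt hpos.le, inv_mul_cancel₀ hpos.ne']
    simp

end schurKet

/-! ### The measurement on Schur states -/

/-- The overlap of the normalized vector `ρ^{-1/2} (|k̃, k, m⟩ ⊗ |ψ⁻⟩)` with the Schur state of
spins `k = s = a / 2` and `j = b / 2`, scaled such that it is `α(s)` for `j = s - 1/2` and `β(s)`
for `j = s + 1/2`. -/
def povmAmp (n a b : ℕ) : ℝ :=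
  -(√(1 / 2 ^ (n + 1)) * singletAmp a b * (√(rhoEig (n + 1) b a))⁻¹)

lemma sqrt_half_div_sqrt_two_pow_mul (n : ℕ) (x y : ℝ) :
    √(1 / 2 * x) / √(2 ^ n * y) = √(1 / 2 ^ (n + 1)) * √x * (√y)⁻¹ := by
  have hpow : √(1 / 2 : ℝ) * (√(2 ^ n))⁻¹ = √(1 / 2 ^ (n + 1)) := by
    rw [← Real.sqrt_inv, ← Real.sqrt_mul (by positivity), pow_succ, one_div, one_div, mul_inv,
      mul_comm]
  rw [Real.sqrt_mul (by positivity), Real.sqrt_mul (by positivity), div_eq_mul_inv, mul_inv, ← hpow]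
  ring

lemma povmAmp_down (n a : ℕ) : povmAmp n a (a - 1) = alpha (n + 1) (a / 2) := by
  obtain _ | a := a
  · simp [povmAmp, singletAmp, alpha]
  · have hs : ((a + 1 : ℕ) : ℝ) / 2 / (2 * (((a + 1 : ℕ) : ℝ) / 2) + 1) =
        1 / 2 * (((a + 1 : ℕ) : ℝ) / ((a + 1 : ℕ) + 1)) := by ring
    have hj : ((a + 1 : ℕ) : ℝ) / 2 - 1 / 2 = a / 2 := by push_cast; ring
    rw [povmAmp, singletAmp_down, Nat.add_sub_cancel, rhoEig_up, alpha, hs, hj,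
      Nat.add_sub_cancel, sqrt_half_div_sqrt_two_pow_mul]
    ring

lemma povmAmp_up (n a : ℕ) : povmAmp n a (a + 1) = beta (n + 1) (a / 2) := by
  have hs : ((a : ℝ) / 2 + 1) / (2 * (a / 2) + 1) = 1 / 2 * ((a + 2) / (a + 1)) := by ring
  have hj : (a : ℝ) / 2 + 1 / 2 = (a + 1) / 2 := by ring
  rw [povmAmp, singletAmp_up, rhoEig_succ_left, beta, hs, hj, Nat.add_sub_cancel, neg_div,
    sqrt_half_div_sqrt_two_pow_mul]

section schurKet

variable {n : ℕ} {spin : Fin (n + 3) → ℕ}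

lemma sigma_last_eq (n : ℕ) :
    sigma (n + 1) (Fin.last n) = ((1 : ℂ) / 2 ^ (n + 1)) • (1 - swapLast n) :=
  sigma_eq (Fin.last n)

lemma povm_last_schurKet_of_ne (h0 : spin 0 = 0)
    (hks : spin (Fin.last n).castSucc.castSucc ≠ spin (Fin.last (n + 2))) (m : ℤ) :
    act (povm (n + 1) (Fin.last n)) (schurKet (n + 2) spin m) =
      ((if spin (Fin.last (n + 2)) = n + 2 then 1 / ((n + 1 : ℕ) : ℝ) else 0 : ℝ) : ℂ) •
        schurKet (n + 2) spin m := by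
  rw [povm, add_act, excess_schurKet h0, mul_act, mul_act, rhoInvSqrt_schurKet h0, act_smul,
    sigma_last_eq, smul_act, sub_act, one_act, swapLast_schurKet_of_ne h0 hks, sub_self, smul_zero,
    smul_zero, act_zero, zero_add]

lemma excess_schurKet_of_eq {a : ℕ} (h : IsCouplingPath spin) (m : ℤ)
    (hk : spin (Fin.last n).castSucc.castSucc = a) (hs : spin (Fin.last (n + 2)) = a) :
    act (excess (n + 1)) (schurKet (n + 2) spin m) = 0 := by
  have hle := h.le (Fin.last n).castSucc.castSucc
  rw [hk, Fin.val_castSucc, Fin.val_castSucc, Fin.val_last] at hle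
  rw [excess_schurKet h.1, if_neg (by rw [hs]; omega), Complex.ofReal_zero, zero_smul]

lemma rhoInvSqrt_appendSinglet {a : ℕ} {m : ℤ} (h0 : spin 0 = 0) (hm : IsWeight a m)
    (hk : spin (Fin.last n).castSucc.castSucc = a) (hs : spin (Fin.last (n + 2)) = a) :
    ((-√(1 / 2 ^ (n + 1)) : ℝ) : ℂ) •
        act (rhoInvSqrt (n + 1)) (appendSinglet (schurKet n (Fin.init (Fin.init spin)) m)) =
      (beta (n + 1) (a / 2) : ℂ) •
          schurKet (n + 2) (Function.update spin (Fin.last (n + 1)).castSucc (a + 1)) m +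
        (alpha (n + 1) (a / 2) : ℂ) •
          schurKet (n + 2) (Function.update spin (Fin.last (n + 1)).castSucc (a - 1)) m := by
  have hs' (b : ℕ) : Function.update spin (Fin.last (n + 1)).castSucc b (Fin.last (n + 2)) = a := by
    rw [Function.update_of_ne (Fin.castSucc_lt_last _).ne', hs]
  rw [appendSinglet_schurKet hm hk hs, act_add, act_smul, act_smul,
    rhoInvSqrt_schurKet (update_zero_of_zero h0 _), rhoInvSqrt_schurKet (update_zero_of_zero h0 _),
    hs', hs', Function.update_self, Function.update_self, ← povmAmp_up, ← povmAmp_down, povmAmp,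
    povmAmp]
  push_cast
  module

lemma povm_last_schurKet_of_eq {a : ℕ} {m : ℤ} (h : IsCouplingPath spin) (hm : IsWeight a m)
    (hk : spin (Fin.last n).castSucc.castSucc = a) (hs : spin (Fin.last (n + 2)) = a) :
    act (povm (n + 1) (Fin.last n)) (schurKet (n + 2) spin m) =
      (povmAmp n a (spin (Fin.last (n + 1)).castSucc) : ℂ) •
        ((beta (n + 1) (a / 2) : ℂ) •
            schurKet (n + 2) (Function.update spin (Fin.last (n + 1)).castSucc (a + 1)) m +
          (alpha (n + 1) (a / 2) : ℂ) •
            schurKet (n + 2) (Function.update spin (Fin.last (n + 1)).castSucc (a - 1)) m) := by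
  have hsq : (1 : ℂ) / 2 ^ (n + 1) = ((√(1 / 2 ^ (n + 1)) : ℝ) : ℂ) * (√(1 / 2 ^ (n + 1)) : ℝ) := by
    rw [← Complex.ofReal_mul, Real.mul_self_sqrt (by positivity)]
    push_cast
    rfl
  rw [povm, add_act, excess_schurKet_of_eq h m hk hs, add_zero, mul_act, mul_act,
    rhoInvSqrt_schurKet h.1, act_smul, act_smul, sigma_last_eq, smul_act, sub_act, one_act,
    schurKet_sub_swapLast h hm hk hs, act_smul, act_smul, hsq,
    ← rhoInvSqrt_appendSinglet h.1 hm hk hs, povmAmp, hs]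
  push_cast
  module

end schurKet

section eigenvalue

variable {n : ℕ} {s : ℝ}

lemma alpha_sq (h0 : 0 ≤ s) (hs : s < ((n : ℝ) + 2) / 2) :
    alpha (n + 1) s ^ 2 = 4 * s / ((2 * s + 1) * (n + 2 - 2 * s)) := by
  have hd : 0 < (n : ℝ) + 2 - 2 * s := by linarith
  have hlam : (2 : ℝ) ^ n * lamMinus (n + 1) (s - 1 / 2) = (n + 2 - 2 * s) / 4 := by
    rw [lamMinus, pow_succ]
    push_cast
    field_simp
    ring
  rw [alpha, div_pow, Nat.add_sub_cancel, hlam, Real.sq_sqrt (by positivity),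
    Real.sq_sqrt (by positivity)]
  field_simp

lemma beta_sq (h0 : 0 ≤ s) :
    beta (n + 1) s ^ 2 = 4 * (s + 1) / ((2 * s + 1) * (n + 4 + 2 * s)) := by
  have hlam : (2 : ℝ) ^ n * lamPlus (n + 1) (s + 1 / 2) = (n + 4 + 2 * s) / 4 := by
    rw [lamPlus, pow_succ]
    push_cast
    field_simp
    ring
  rw [beta, div_pow, neg_sq, Nat.add_sub_cancel, hlam, Real.sq_sqrt (by positivity),
    Real.sq_sqrt (by positivity)]
  field_simp

lemma alpha_sq_add_beta_sq (h0 : 0 ≤ s) (hs : s < (((n + 1 : ℕ) : ℝ) + 1) / 2) :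
    alpha (n + 1) s ^ 2 + beta (n + 1) s ^ 2 =
      4 * (((n + 1 : ℕ) : ℝ) + 1) /
        ((((n + 1 : ℕ) : ℝ) + 1 - 2 * s) * (((n + 1 : ℕ) : ℝ) + 3 + 2 * s)) := by
  have hcast : ((n + 1 : ℕ) : ℝ) + 1 = n + 2 := by push_cast; ring
  rw [hcast] at hs
  have hd : (n : ℝ) + 2 - 2 * s ≠ 0 := by linarith
  have hd' : (n : ℝ) + 4 + 2 * s ≠ 0 := by positivity
  have hd'' : 2 * s + 1 ≠ 0 := by positivity
  have hcast' : ((n + 1 : ℕ) : ℝ) + 3 = n + 4 := by push_cast; ring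
  rw [alpha_sq h0 hs, beta_sq h0, hcast, hcast']
  rw [div_add_div _ _ (mul_ne_zero hd'' hd) (mul_ne_zero hd'' hd'),
    div_eq_div_iff (by simp [hd, hd', hd'']) (mul_ne_zero hd hd')]
  ring

end eigenvalue

/-! ### The rotated basis -/

section rotate

variable {ι : Type*} {f : ι → ι}

lemma orthonormal_rotate {𝕜 E : Type*} [RCLike 𝕜] [SeminormedAddCommGroup E]
    [InnerProductSpace 𝕜 E] {v : ι → E} {p q : ι → ℝ} (hv : Orthonormal 𝕜 v)
    (hf : Function.Involutive f) (hp : ∀ i, p (f i) = p i) (hq : ∀ i, q (f i) = -q i)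
    (hpq : ∀ i, p i ^ 2 + q i ^ 2 = 1) :
    Orthonormal 𝕜 fun i => (p i : 𝕜) • v i + (q i : 𝕜) • v (f i) := by
  classical
  rw [orthonormal_iff_ite] at hv ⊢
  intro i j
  have hinner : inner 𝕜 ((p i : 𝕜) • v i + (q i : 𝕜) • v (f i))
      ((p j : 𝕜) • v j + (q j : 𝕜) • v (f j)) =
        (p i * p j + q i * q j : 𝕜) * (if i = j then 1 else 0) +
          (p i * q j + q i * p j) * (if i = f j then 1 else 0) := by
    simp only [inner_add_left, inner_add_right, inner_smul_left, inner_smul_right, hv,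
      RCLike.conj_ofReal, hf.injective.eq_iff, hf.eq_iff]
    ring
  have hdiag : (p i * p j + q i * q j : 𝕜) * (if i = j then 1 else 0) =
      if i = j then 1 else 0 := by
    split_ifs with hij
    · rw [← hij, mul_one, ← sq, ← sq]
      exact_mod_cast hpq i
    · rw [mul_zero]
  have hcross : (p i * q j + q i * p j : 𝕜) * (if i = f j then 1 else 0) = 0 := by
    split_ifs with hij
    · rw [hij, hp, hq, RCLike.ofReal_neg]
      ring
    · rw [mul_zero]
  rw [hinner, hdiag, hcross, add_zero]

lemma span_rotate {R E : Type*} [CommRing R] [AddCommGroup E] [Module R E] {v : ι → E}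
    {p q : ι → R} (hv : Submodule.span R (Set.range v) = ⊤) (hf : Function.Involutive f)
    (hp : ∀ i, p (f i) = p i) (hq : ∀ i, q (f i) = -q i) (hpq : ∀ i, p i ^ 2 + q i ^ 2 = 1) :
    Submodule.span R (Set.range fun i => p i • v i + q i • v (f i)) = ⊤ := by
  set w : ι → E := fun i => p i • v i + q i • v (f i) with hw
  have hvw (i : ι) : v i = p i • w i - q i • w (f i) := by
    rw [hw]
    dsimp only
    rw [hp, hq, hf i]
    calc v i = (p i ^ 2 + q i ^ 2) • v i := by rw [hpq, one_smul]
      _ = _ := by module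
  rw [eq_top_iff, ← hv, Submodule.span_le]
  rintro _ ⟨i, rfl⟩
  rw [hvw]
  exact Submodule.sub_mem _ (Submodule.smul_mem _ _ (Submodule.subset_span ⟨i, rfl⟩))
    (Submodule.smul_mem _ _ (Submodule.subset_span ⟨f i, rfl⟩))

end rotate

lemma IsCouplingPath.update_penultimate {n b : ℕ} {spin : Fin (n + 3) → ℕ}
    (h : IsCouplingPath spin)
    (hks : spin (Fin.last n).castSucc.castSucc = spin (Fin.last (n + 2)))
    (hb : Step (spin (Fin.last (n + 2))) b) :
    IsCouplingPath (Function.update spin (Fin.last (n + 1)).castSucc b) := by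
  have hb' : Step b (spin (Fin.last (n + 2))) := hb.symm
  have hlast : Function.update spin (Fin.last (n + 1)).castSucc b (Fin.last (n + 2)) =
      spin (Fin.last (n + 2)) := Function.update_of_ne (Fin.castSucc_lt_last _).ne' _ _
  have hk : Function.update (Fin.init spin) (Fin.last (n + 1)) b (Fin.last n).castSucc =
      spin (Fin.last n).castSucc.castSucc := Function.update_of_ne (Fin.castSucc_lt_last _).ne _ _
  rw [isCouplingPath_succ, isCouplingPath_succ, Fin.init_update_castSucc, Fin.init_update_last, hk,
    hlast, Function.update_self, Function.update_self, hks]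
  exact ⟨⟨h.init.init, hb⟩, hb'⟩

lemma alpha_zero (N : ℕ) : alpha N 0 = 0 := by simp [alpha]

namespace SchurLabel

variable {n : ℕ} (x : SchurLabel (n + 1 + 1))

lemma s_nonneg : 0 ≤ x.s := by
  rw [s]
  positivity

lemma s_eq_zero {x : SchurLabel (n + 1 + 1)} (h : x.twoS = 0) : x.s = 0 := by
  rw [s, h, Nat.cast_zero, zero_div]

lemma twoJ_cases : x.twoS = x.twoJ + 1 ∨ x.twoJ = x.twoS + 1 := x.isCouplingPath.step_last

lemma twoS_ne_of_twoK_eq_twoS {x : SchurLabel (n + 1 + 1)} (hk : x.twoK = x.twoS) :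
    x.twoS ≠ n + 1 + 1 := by
  have hle : x.twoK ≤ n := x.isCouplingPath.le (Fin.last n).castSucc.castSucc
  omega

lemma rotNorm_pos : 0 < x.rotNorm := by
  have hs := x.s_nonneg
  have hβ : 0 < beta (n + 1) x.s ^ 2 := by
    rw [beta_sq hs]
    positivity
  exact Real.sqrt_pos.2 (by positivity)

lemma rotNorm_sq : x.rotNorm ^ 2 = alpha (n + 1) x.s ^ 2 + beta (n + 1) x.s ^ 2 :=
  Real.sq_sqrt (by positivity)

lemma ketWithJ_twoJ : x.ketWithJ x.twoJ = schurState x := by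
  rw [ketWithJ, twoJ, Function.update_eq_self, schurState]

lemma lowerKet_eq_zero {x : SchurLabel (n + 1 + 1)} (hs : x.twoS = 0) : x.lowerKet = 0 := by
  by_contra hne
  have hstep := (isCouplingPath_of_schurKet_ne_zero (update_zero_of_zero x.spin_zero _)
    hne).1.step_last
  rw [Function.update_of_ne (Fin.castSucc_lt_last _).ne'] at hstep
  have hlast : x.spin (Fin.last (n + 2)) = 0 := hs
  simp [Step, hs, hlast] at hstep

lemma povm_ketWithJ {x : SchurLabel (n + 1 + 1)} {b : ℕ} (hk : x.twoK = x.twoS)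
    (hb : Step x.twoS b) :
    act (povm (n + 1) (Fin.last n)) (x.ketWithJ b) =
      (povmAmp n x.twoS b : ℂ) •
        ((beta (n + 1) x.s : ℂ) • x.upperKet + (alpha (n + 1) x.s : ℂ) • x.lowerKet) := by
  have hlast : Function.update x.spin (Fin.last (n + 1)).castSucc b (Fin.last (n + 2)) = x.twoS :=
    Function.update_of_ne (Fin.castSucc_lt_last _).ne' _ _
  have hk' : Function.update x.spin (Fin.last (n + 1)).castSucc b
      (Fin.last n).castSucc.castSucc = x.twoS := by
    rw [Function.update_of_ne (by simp [Fin.ext_iff])]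
    exact hk
  have hpath := x.isCouplingPath.update_penultimate hk hb
  have := povm_last_schurKet_of_eq hpath x.isWeight hk' hlast
  rwa [Function.update_self, Function.update_idem, Function.update_idem] at this

lemma povm_upperKet {x : SchurLabel (n + 1 + 1)} (hk : x.twoK = x.twoS) :
    act (povm (n + 1) (Fin.last n)) x.upperKet =
      (beta (n + 1) x.s : ℂ) •
        ((beta (n + 1) x.s : ℂ) • x.upperKet + (alpha (n + 1) x.s : ℂ) • x.lowerKet) := by
  rw [upperKet, povm_ketWithJ hk (Or.inl rfl), povmAmp_up]
  rfl

lemma povm_lowerKet {x : SchurLabel (n + 1 + 1)} (hk : x.twoK = x.twoS) :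
    act (povm (n + 1) (Fin.last n)) x.lowerKet =
      (alpha (n + 1) x.s : ℂ) •
        ((beta (n + 1) x.s : ℂ) • x.upperKet + (alpha (n + 1) x.s : ℂ) • x.lowerKet) := by
  by_cases h0 : x.twoS = 0
  · rw [lowerKet_eq_zero h0, act_zero, s_eq_zero h0, alpha_zero, Complex.ofReal_zero, zero_smul]
  · have hstep : Step x.twoS (x.twoS - 1) := Or.inr (by omega)
    rw [lowerKet, povm_ketWithJ hk hstep, povmAmp_down]
    rfl

lemma povm_rotMinus {x : SchurLabel (n + 1 + 1)} (hk : x.twoK = x.twoS) :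
    act (povm (n + 1) (Fin.last n)) x.rotMinus = 0 := by
  rw [rotMinus, act_sub, act_smul, act_smul, povm_upperKet hk, povm_lowerKet hk]
  push_cast
  module

lemma povm_rotPlus {x : SchurLabel (n + 1 + 1)} (hk : x.twoK = x.twoS) :
    act (povm (n + 1) (Fin.last n)) x.rotPlus =
      ((alpha (n + 1) x.s ^ 2 + beta (n + 1) x.s ^ 2 : ℝ) : ℂ) • x.rotPlus := by
  rw [rotPlus, act_add, act_smul, act_smul, povm_upperKet hk, povm_lowerKet hk]
  push_cast
  module

lemma povm_eigVec : act (povm (n + 1) (Fin.last n)) x.eigVec = (x.eigVal : ℂ) • x.eigVec := by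
  by_cases hk : x.twoK = x.twoS
  · rw [eigVec, if_pos hk, eigVal, if_neg (twoS_ne_of_twoK_eq_twoS hk)]
    by_cases hj : x.twoJ + 1 = x.twoS
    · rw [if_pos hj, if_neg (by omega), povm_rotMinus hk, Complex.ofReal_zero, zero_smul]
    · have hj' : x.twoJ = x.twoS + 1 := by have := x.twoJ_cases; omega
      rw [if_neg hj, if_pos ⟨hk, hj'⟩, povm_rotPlus hk]
  · rw [eigVec, if_neg hk, schurState, povm_last_schurKet_of_ne x.spin_zero hk, eigVal,
      if_neg fun h : x.twoK = x.twoS ∧ _ => hk h.1]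
    rfl

/-- The label with `j = s - 1/2` and `j = s + 1/2` exchanged if `k = s > 0`, and `x` itself
otherwise. It pairs the Schur states that are rotated into each other. -/
def flipJ : SchurLabel (n + 1 + 1) :=
  if h : x.twoK = x.twoS ∧ x.twoS ≠ 0 then
    have hpath : IsCouplingPath
        (Function.update x.spin (Fin.last (n + 1)).castSucc (2 * x.twoS - x.twoJ)) :=
      x.isCouplingPath.update_penultimate h.1 (by
        have := x.twoJ_cases
        change 2 * x.twoS - x.twoJ = x.twoS + 1 ∨ x.twoS = 2 * x.twoS - x.twoJ + 1
        omega)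
    { spin := Function.update x.spin (Fin.last (n + 1)).castSucc (2 * x.twoS - x.twoJ)
      spin_zero := hpath.1
      spin_step := hpath.2
      m := x.m
      m_range := by
        rw [Function.update_of_ne (Fin.castSucc_lt_last _).ne']
        exact x.m_range
      m_parity := by
        rw [Function.update_of_ne (Fin.castSucc_lt_last _).ne']
        exact x.m_parity }
  else x

lemma flipJ_of_not {x : SchurLabel (n + 1 + 1)} (h : ¬(x.twoK = x.twoS ∧ x.twoS ≠ 0)) :
    x.flipJ = x := dif_neg h

lemma spin_flipJ {x : SchurLabel (n + 1 + 1)} (h : x.twoK = x.twoS ∧ x.twoS ≠ 0) :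
    x.flipJ.spin =
      Function.update x.spin (Fin.last (n + 1)).castSucc (2 * x.twoS - x.twoJ) := by
  rw [flipJ, dif_pos h]

lemma m_flipJ : x.flipJ.m = x.m := by
  rw [flipJ]
  split_ifs <;> rfl

lemma twoK_flipJ : x.flipJ.twoK = x.twoK := by
  by_cases h : x.twoK = x.twoS ∧ x.twoS ≠ 0
  · rw [twoK, spin_flipJ h]
    exact Function.update_of_ne (by simp [Fin.ext_iff]) _ _
  · rw [flipJ_of_not h]

lemma twoS_flipJ : x.flipJ.twoS = x.twoS := by
  by_cases h : x.twoK = x.twoS ∧ x.twoS ≠ 0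
  · rw [twoS, spin_flipJ h]
    exact Function.update_of_ne (Fin.castSucc_lt_last _).ne' _ _
  · rw [flipJ_of_not h]

lemma twoJ_flipJ {x : SchurLabel (n + 1 + 1)} (h : x.twoK = x.twoS ∧ x.twoS ≠ 0) :
    x.flipJ.twoJ = 2 * x.twoS - x.twoJ := by
  rw [twoJ, spin_flipJ h]
  exact Function.update_self _ _ _

lemma s_flipJ : x.flipJ.s = x.s := by
  rw [s, s, twoS_flipJ]

lemma rotNorm_flipJ : x.flipJ.rotNorm = x.rotNorm := by
  rw [rotNorm, rotNorm, s_flipJ]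

lemma flipJ_involutive : Function.Involutive (flipJ (n := n)) := by
  intro x
  by_cases h : x.twoK = x.twoS ∧ x.twoS ≠ 0
  · have h' : x.flipJ.twoK = x.flipJ.twoS ∧ x.flipJ.twoS ≠ 0 := by rwa [twoK_flipJ, twoS_flipJ]
    have hj : 2 * x.twoS - (2 * x.twoS - x.twoJ) = x.twoJ := by have := x.twoJ_cases; omega
    refine SchurLabel.ext ?_ (by rw [m_flipJ, m_flipJ])
    rw [spin_flipJ h', spin_flipJ h, twoS_flipJ, twoJ_flipJ h, Function.update_idem, hj]
    exact Function.update_eq_self _ _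
  · rw [flipJ_of_not h, flipJ_of_not h]

lemma schurState_flipJ {x : SchurLabel (n + 1 + 1)} (h : x.twoK = x.twoS ∧ x.twoS ≠ 0) :
    schurState x.flipJ = x.ketWithJ (2 * x.twoS - x.twoJ) := by
  rw [schurState, spin_flipJ h, m_flipJ]
  rfl

/-- The coefficient of `eigVec x` at the Schur state of `x`. -/
def coeffSelf : ℝ :=
  if x.twoK = x.twoS then beta (n + 1) x.s / x.rotNorm else 1

/-- The coefficient of `eigVec x` at the Schur state of `x.flipJ`. -/
def coeffFlip : ℝ :=
  if x.twoK = x.twoS then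
    if x.twoJ + 1 = x.twoS then -(alpha (n + 1) x.s / x.rotNorm)
    else alpha (n + 1) x.s / x.rotNorm
  else 0

lemma coeffSelf_flipJ : x.flipJ.coeffSelf = x.coeffSelf := by
  rw [coeffSelf, coeffSelf, twoK_flipJ, twoS_flipJ, s_flipJ, rotNorm_flipJ]

lemma coeffFlip_flipJ : x.flipJ.coeffFlip = -x.coeffFlip := by
  by_cases h : x.twoK = x.twoS ∧ x.twoS ≠ 0
  · have := x.twoJ_cases
    rw [coeffFlip, coeffFlip, twoK_flipJ, twoS_flipJ, s_flipJ, rotNorm_flipJ, twoJ_flipJ h,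
      if_pos h.1, if_pos h.1]
    by_cases hj : x.twoJ + 1 = x.twoS
    · rw [if_pos hj, if_neg (by omega), neg_neg]
    · rw [if_neg hj, if_pos (by omega)]
  · have hzero : x.coeffFlip = 0 := by
      by_cases hk : x.twoK = x.twoS
      · have h0 : x.twoS = 0 := by_contra fun h0 => h ⟨hk, h0⟩
        simp [coeffFlip, s_eq_zero h0, alpha_zero]
      · exact if_neg hk
    rw [flipJ_of_not h, hzero, neg_zero]

lemma coeffSelf_sq_add_coeffFlip_sq : x.coeffSelf ^ 2 + x.coeffFlip ^ 2 = 1 := by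
  by_cases hk : x.twoK = x.twoS
  · have hflip : x.coeffFlip ^ 2 = (alpha (n + 1) x.s / x.rotNorm) ^ 2 := by
      rw [coeffFlip, if_pos hk]
      split_ifs
      · rw [neg_sq]
      · rfl
    rw [hflip, coeffSelf, if_pos hk, div_pow, div_pow, ← add_div, add_comm, ← rotNorm_sq,
      div_self (pow_pos x.rotNorm_pos 2).ne']
  · simp [coeffSelf, coeffFlip, hk]

lemma eigVec_eq :
    x.eigVec = (x.coeffSelf : ℂ) • schurState x + (x.coeffFlip : ℂ) • schurState x.flipJ := by
  by_cases hk : x.twoK = x.twoS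
  · have hcases := x.twoJ_cases
    rw [eigVec, coeffSelf, coeffFlip, if_pos hk, if_pos hk, if_pos hk, ← ketWithJ_twoJ]
    by_cases hj : x.twoJ + 1 = x.twoS
    · have hlower : x.twoS - 1 = x.twoJ := by omega
      have hupper : x.twoS + 1 = 2 * x.twoS - x.twoJ := by omega
      rw [if_pos hj, if_pos hj, schurState_flipJ ⟨hk, by omega⟩, rotMinus, lowerKet, upperKet,
        hlower, hupper, Complex.ofReal_neg, neg_smul, sub_eq_add_neg]
    · have hupper : x.twoS + 1 = x.twoJ := by omega
      rw [if_neg hj, if_neg hj, rotPlus, upperKet, hupper,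
        add_comm (_ • x.lowerKet)]
      by_cases h0 : x.twoS = 0
      · rw [s_eq_zero h0, alpha_zero, zero_div, Complex.ofReal_zero, zero_smul, zero_smul]
      · have hlower : x.twoS - 1 = 2 * x.twoS - x.twoJ := by omega
        rw [schurState_flipJ ⟨hk, h0⟩, lowerKet, hlower]
  · simp [eigVec, coeffSelf, coeffFlip, hk]

lemma isONB_eigVec (n : ℕ) : IsONB (eigVec (N := n + 1)) := by
  rw [funext eigVec_eq]
  exact ⟨orthonormal_rotate orthonormal_schurState flipJ_involutive coeffSelf_flipJ
      coeffFlip_flipJ coeffSelf_sq_add_coeffFlip_sq,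
    span_rotate (span_schurState _) flipJ_involutive (by simp [coeffSelf_flipJ])
      (by simp [coeffFlip_flipJ]) (by exact_mod_cast coeffSelf_sq_add_coeffFlip_sq)⟩

end SchurLabel

/-! ### Exchanging ports -/

lemma isONB_swapOp_act {ι : Type} {n : ℕ} {v : ι → Qubits n} (hv : IsONB v) (a b : Fin n) :
    IsONB fun i => act (swapOp a b) (v i) := by
  classical
  constructor
  · have hortho := hv.1
    rw [orthonormal_iff_ite] at hortho ⊢
    intro i j
    rw [← hortho i j, PiLp.inner_apply, PiLp.inner_apply]
    simp only [swapOp_act_apply]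
    exact (Equiv.arrowCongr (Equiv.swap a b) (Equiv.refl (Fin 2))).sum_comp
      fun x => inner ℂ (v i x) (v j x)
  · have hsurj : Function.Surjective (Matrix.toEuclideanLin (swapOp a b)) := fun u =>
      ⟨act (swapOp a b) u, by
        change act (swapOp a b) (act (swapOp a b) u) = u
        rw [← mul_act, swapOp_mul_self, one_act]⟩
    change Submodule.span ℂ (Set.range (Matrix.toEuclideanLin (swapOp a b) ∘ v)) = ⊤
    rw [Set.range_comp, Submodule.span_image, hv.2, Submodule.map_top,
      LinearMap.range_eq_top.2 hsurj]

section conj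

variable {N : ℕ} (i j : Fin N)

lemma sigma_conj (l : Fin N) :
    swapOp i.castSucc j.castSucc * sigma N l * swapOp i.castSucc j.castSucc =
      sigma N (Equiv.swap i j l) := by
  have hl : Equiv.swap i.castSucc j.castSucc l.castSucc = (Equiv.swap i j l).castSucc :=
    (Fin.castSucc_injective N).swap_apply i j l
  rw [sigma_eq, sigma_eq, mul_smul_comm, smul_mul_assoc, mul_sub, sub_mul, mul_one,
    swapOp_mul_self, swapOp_conj, hl,
    Equiv.swap_apply_of_ne_of_ne (Fin.castSucc_lt_last i).ne' (Fin.castSucc_lt_last j).ne']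

lemma rho_conj : swapOp i.castSucc j.castSucc * rho N * swapOp i.castSucc j.castSucc = rho N := by
  rw [rho, Finset.mul_sum, Finset.sum_mul, Finset.sum_congr rfl fun l _ => sigma_conj i j l]
  exact Equiv.sum_comp (Equiv.swap i j) (sigma N)

lemma commute_rho_swapOp : Commute (rho N) (swapOp i.castSucc j.castSucc) := by
  have h := congrArg (swapOp i.castSucc j.castSucc * ·) (rho_conj i j)
  simp only [← mul_assoc, swapOp_mul_self, one_mul] at h
  exact h

lemma commute_rhoInvSqrt_swapOp : Commute (rhoInvSqrt N) (swapOp i.castSucc j.castSucc) :=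
  (commute_rho_swapOp i j).cfc_real _

lemma commute_excess_swapOp : Commute (excess N) (swapOp i.castSucc j.castSucc) := by
  have hR := commute_rhoInvSqrt_swapOp i j
  rw [excess_eq]
  exact ((Commute.one_left _).sub_left
    ((hR.mul_left (commute_rho_swapOp i j)).mul_left hR)).smul_left _

lemma povm_conj :
    povm N i = swapOp i.castSucc j.castSucc * povm N j * swapOp i.castSucc j.castSucc := by
  have hσ := sigma_conj i j j
  rw [Equiv.swap_apply_right] at hσ
  have hR := (commute_rhoInvSqrt_swapOp i j).eq
  have hE : swapOp i.castSucc j.castSucc * excess N * swapOp i.castSucc j.castSucc = excess N := by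
    rw [← (commute_excess_swapOp i j).eq, mul_assoc, swapOp_mul_self, mul_one]
  rw [povm, povm, mul_add, add_mul, hE, ← hσ]
  congr 1
  generalize swapOp i.castSucc j.castSucc = s at hR
  calc rhoInvSqrt N * (s * sigma N j * s) * rhoInvSqrt N
      = rhoInvSqrt N * s * sigma N j * (s * rhoInvSqrt N) := by noncomm_ring
    _ = s * rhoInvSqrt N * sigma N j * (rhoInvSqrt N * s) := by rw [hR]
    _ = s * (rhoInvSqrt N * sigma N j * rhoInvSqrt N) * s := by noncomm_ring

end conj

end

end PBT


theorem mainTheorem1 (N : ℕ) (hN : 1 ≤ N) :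
    -- the kets `|k, j, s, m⟩` form the Schur (sequentially coupled spin) eigenbasis
    PBT.IsSpinEigenbasis (PBT.schurState (n := N + 1)) ∧
    -- the rotated vectors form an orthonormal basis of eigenvectors of `Π_N`
    PBT.IsONB (PBT.SchurLabel.eigVec (N := N)) ∧
    (∀ x : PBT.SchurLabel (N + 1),
      PBT.act (PBT.povm N (PBT.lastPort N hN)) x.eigVec = ((x.eigVal : ℝ) : ℂ) • x.eigVec) ∧
    -- the nonzero eigenvalue below maximal spin
    (∀ x : PBT.SchurLabel (N + 1), x.s < ((N : ℝ) + 1) / 2 →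
      PBT.alpha N x.s ^ 2 + PBT.beta N x.s ^ 2 =
        4 * ((N : ℝ) + 1) / (((N : ℝ) + 1 - 2 * x.s) * ((N : ℝ) + 3 + 2 * x.s))) ∧
    -- the other POVM elements, by conjugation with `SWAP_{A_i A_N}`
    (∀ i : Fin N,
      PBT.povm N i =
        PBT.swapOp i.castSucc (PBT.lastPort N hN).castSucc * PBT.povm N (PBT.lastPort N hN) *
          PBT.swapOp i.castSucc (PBT.lastPort N hN).castSucc ∧
      PBT.IsONB (fun x : PBT.SchurLabel (N + 1) =>
        PBT.act (PBT.swapOp i.castSucc (PBT.lastPort N hN).castSucc) x.eigVec) ∧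
      ∀ x : PBT.SchurLabel (N + 1),
        PBT.act (PBT.povm N i)
            (PBT.act (PBT.swapOp i.castSucc (PBT.lastPort N hN).castSucc) x.eigVec) =
          ((x.eigVal : ℝ) : ℂ) •
            PBT.act (PBT.swapOp i.castSucc (PBT.lastPort N hN).castSucc) x.eigVec) := by
  obtain ⟨n, rfl⟩ : ∃ n, N = n + 1 := ⟨N - 1, by omega⟩
  have heig (x : PBT.SchurLabel (n + 1 + 1)) :
      PBT.act (PBT.povm (n + 1) (PBT.lastPort (n + 1) hN)) x.eigVec =
        ((x.eigVal : ℝ) : ℂ) • x.eigVec := x.povm_eigVec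
  have honb := PBT.SchurLabel.isONB_eigVec n
  refine ⟨PBT.isSpinEigenbasis_schurState _, honb, heig,
    fun x hx => PBT.alpha_sq_add_beta_sq x.s_nonneg hx,
    fun i => ⟨PBT.povm_conj i _, PBT.isONB_swapOp_act honb _ _, fun x => ?_⟩⟩
  rw [PBT.povm_conj i (PBT.lastPort (n + 1) hN), PBT.mul_act, PBT.mul_act,
    ← PBT.mul_act (PBT.swapOp _ _) (PBT.swapOp _ _), PBT.swapOp_mul_self, PBT.one_act, heig,
    PBT.act_smul]
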